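/- Let $H$ be a real Hilbert space with norm $\|\cdot\|$, and let $A:D(A)\subset H\to H$ be a strictly positive selfadjoint operator (no compactness assumed), that is, $A$ is selfadjoint and $\langle Ax,x\rangle\ge c\|x\|^2$ on $D(A)$ for some $c>0$. Let $\lambda_1>0$ be the minimum of the spectrum of $A$, let $H^1=D(A^{1/2})$ with $\|x\|_1=\|A^{1/2}x\|$, and let $\mathcal H=H^1\times H^1\times H\times H$. Fix $\alpha,\beta,\gamma,\kappa>0$ with $\mu=\gamma-\alpha\beta\ge 0$, let $\eta\in\mathbb R$, and consider the system $$u_{ttt}+\alpha u_{tt}+\beta Au_t+\gamma Au=\eta A\theta,\qquad \theta_t+\kappa A\theta=-\eta Au_{tt}-\alpha\eta Au_t .$$ A weak solution is a map $t\mapsto(u(t),u_t(t),u_{tt}(t),\theta(t))\in C([0,\infty),\mathcal H)$, where $u_t$ and $u_{tt}$ are derivatives in $H$, such that for every $\varphi\in D(A)$ and $t\ge0$ $$\tfrac{d}{dt}\langle u_{tt},\varphi\rangle+\alpha\langle u_{tt},\varphi\rangle+\beta\langle u_t,A\varphi\rangle+\gamma\langle u,A\varphi\rangle=\eta\langle\theta,A\varphi\rangle,$$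 $$\tfrac{d}{dt}\langle\theta,\varphi\rangle+\kappa\langle\theta,A\varphi\rangle=-\eta\langle u_{tt},A\varphi\rangle-\alpha\eta\langle u_t,A\varphi\rangle .$$ Its energy is $$E(t)=\tfrac12\Big[\|u_t(t)+\alpha u(t)\|_1^2+\|u_{tt}(t)+\alpha u_t(t)\|^2+\|u_t(t)\|_1^2+\|\theta(t)\|^2\Big].$$ Define $$\mathfrak t(\kappa)=\begin{cases}\dfrac{2\kappa}{\alpha^2}\Big(1-\dfrac{\alpha}{\kappa\lambda_1}+\dfrac{\alpha^2}{\kappa^2\lambda_1^2}\Big)&\text{if }\kappa<\alpha/\lambda_1,\\[2mm]\dfrac{2\kappa}{\alpha^2}&\text{if }\kappa\ge\alpha/\lambda_1.\end{cases}$$ If $\eta^2>\mathfrak t(\kappa)\,\mu$, then the system is exponentially stable: for every initial datum in $\mathcal H$ there is exactly one weak solution on $[0,\infty)$ (so that the solution semigroup on $\mathcal H$ is defined), and there are constants $M\ge1$ and $\omega>0$, independent of the initial datum, such that $$E(t)\le M\,E(0)\,e^{-\omega t}\qquad\text{for all }t\ge0$$ along every weak solution. In particular, when $\mu=0$ the system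 is exponentially stable for every $\eta\ne0$. -/

import Mathlib

noncomputable section

namespace MGTFourier

open scoped InnerProductSpace Topology
open Set Filter

variable {H : Type*} [NormedAddCommGroup H] [InnerProductSpace ℝ H]

/-! ### Square roots of bounded operators -/

/-- Visser iteration for `1 - √(1 - b)`. -/
def sqrtIter (b : H →L[ℝ] H) : ℕ → (H →L[ℝ] H)
  | 0 => 0
  | n + 1 => (1 / 2 : ℝ) • (b + sqrtIter b n * sqrtIter b n)

/-- Scalar majorant of the iteration. -/
def sqrtMaj : ℕ → ℝ
  | 0 => 0
  | n + 1 => (1 / 2 : ℝ) * (1 + sqrtMaj n * sqrtMaj n)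

theorem sqrtMaj_bounds (n : ℕ) : 0 ≤ sqrtMaj n ∧ sqrtMaj n ≤ 1 := by
  induction n with
  | zero => simp [sqrtMaj]
  | succ n ih => simp only [sqrtMaj]; constructor <;> nlinarith [ih.1, ih.2]

theorem sqrtIter_commute {b C : H →L[ℝ] H} (h : Commute C b) (n : ℕ) :
    Commute C (sqrtIter b n) := by
  induction n with
  | zero => exact Commute.zero_right C
  | succ n ih => exact (h.add_right (ih.mul_right ih)).smul_right _

theorem sqrtIter_norm_le {b : H →L[ℝ] H} (hb : ‖b‖ ≤ 1) (n : ℕ) :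
    ‖sqrtIter b n‖ ≤ sqrtMaj n := by
  induction n with
  | zero => simp [sqrtIter, sqrtMaj]
  | succ n ih =>
    simp only [sqrtIter, sqrtMaj]
    rw [norm_smul, Real.norm_of_nonneg (by norm_num)]
    have h1 : ‖sqrtIter b n * sqrtIter b n‖ ≤ sqrtMaj n * sqrtMaj n :=
      (norm_mul_le _ _).trans (mul_le_mul ih ih (norm_nonneg _) (sqrtMaj_bounds n).1)
    have := norm_add_le b (sqrtIter b n * sqrtIter b n)
    nlinarith

theorem sqrtIter_dist_le {b : H →L[ℝ] H} (hb : ‖b‖ ≤ 1) (n : ℕ) :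
    ‖sqrtIter b (n + 1) - sqrtIter b n‖ ≤ sqrtMaj (n + 1) - sqrtMaj n := by
  induction n with
  | zero =>
    have := sqrtIter_norm_le hb 1
    simpa [sqrtIter, sqrtMaj] using this
  | succ n ih =>
    have hc : Commute (sqrtIter b (n + 1)) (sqrtIter b n) :=
      sqrtIter_commute (sqrtIter_commute (Commute.refl b) (n + 1)).symm n
    have h1 : sqrtIter b (n + 1 + 1) - sqrtIter b (n + 1) = (1 / 2 : ℝ) •
        ((sqrtIter b (n + 1) + sqrtIter b n) * (sqrtIter b (n + 1) - sqrtIter b n)) := by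
      rw [← hc.mul_self_sub_mul_self_eq]
      conv_lhs => rw [sqrtIter, sqrtIter]
      rw [← smul_sub]
      congr 1
      rw [← sqrtIter]
      abel
    have h2 : sqrtMaj (n + 1 + 1) - sqrtMaj (n + 1) = (1 / 2 : ℝ) *
        ((sqrtMaj (n + 1) + sqrtMaj n) * (sqrtMaj (n + 1) - sqrtMaj n)) := by
      have e1 : sqrtMaj (n + 1 + 1) = (1 / 2 : ℝ) * (1 + sqrtMaj (n + 1) * sqrtMaj (n + 1)) := rfl
      have e2 : sqrtMaj (n + 1) = (1 / 2 : ℝ) * (1 + sqrtMaj n * sqrtMaj n) := rfl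
      rw [e1]
      nlinarith [e2]
    rw [h1, h2, norm_smul, Real.norm_of_nonneg (by norm_num)]
    refine mul_le_mul_of_nonneg_left ((norm_mul_le _ _).trans ?_) (by norm_num)
    exact mul_le_mul
      ((norm_add_le _ _).trans (add_le_add (sqrtIter_norm_le hb _) (sqrtIter_norm_le hb _)))
      ih (norm_nonneg _) (add_nonneg (sqrtMaj_bounds _).1 (sqrtMaj_bounds _).1)

theorem exists_sqrtIter_limit [CompleteSpace H] {b : H →L[ℝ] H} (hb : ‖b‖ ≤ 1) :
    ∃ Y : H →L[ℝ] H, Tendsto (sqrtIter b) atTop (𝓝 Y) := by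
  have hsum : Summable fun n => sqrtMaj (n + 1) - sqrtMaj n := by
    refine summable_of_sum_range_le (c := 1)
      (fun n => (norm_nonneg _).trans (sqrtIter_dist_le (H := H) hb n)) fun n => ?_
    rw [Finset.sum_range_sub]
    linarith [(sqrtMaj_bounds n).2, (sqrtMaj_bounds 0).1]
  have hcau : CauchySeq (sqrtIter b) := by
    refine cauchySeq_of_dist_le_of_summable _ (fun n => ?_) hsum
    rw [dist_comm, dist_eq_norm]
    exact sqrtIter_dist_le hb n
  exact cauchySeq_tendsto_of_complete hcau

theorem sqrtIter_selfAdjoint [CompleteSpace H] {b : H →L[ℝ] H} (hb : IsSelfAdjoint b) (n : ℕ) :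
    IsSelfAdjoint (sqrtIter b n) := by
  induction n with
  | zero => exact IsSelfAdjoint.zero _
  | succ n ih =>
    have h1 : IsSelfAdjoint (sqrtIter b n * sqrtIter b n) := by
      rw [← pow_two]; exact ih.pow 2
    exact (IsSelfAdjoint.all (1 / 2 : ℝ)).smul (hb.add h1)

theorem exists_sqrt_one_sub [CompleteSpace H] {b : H →L[ℝ] H} (hb : ‖b‖ ≤ 1)
    (hbs : IsSelfAdjoint b) :
    ∃ S : H →L[ℝ] H, IsSelfAdjoint S ∧ (∀ x, 0 ≤ ⟪S x, x⟫_ℝ) ∧ S * S = 1 - b ∧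
      ∀ C : H →L[ℝ] H, Commute C b → Commute C S := by
  obtain ⟨Y, hY⟩ := exists_sqrtIter_limit hb
  have hYn : ‖Y‖ ≤ 1 := le_of_tendsto hY.norm
    (Eventually.of_forall fun n => (sqrtIter_norm_le hb n).trans (sqrtMaj_bounds n).2)
  have hfix : Y = (1 / 2 : ℝ) • (b + Y * Y) :=
    tendsto_nhds_unique ((tendsto_add_atTop_iff_nat 1).2 hY)
      (((tendsto_const_nhds (x := b)).add (hY.mul hY)).const_smul (1 / 2 : ℝ))
  have hYs : IsSelfAdjoint Y := by
    have h1 : Tendsto (fun n => star (sqrtIter b n)) atTop (𝓝 (star Y)) :=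
      (continuous_star.tendsto Y).comp hY
    have h2 : Tendsto (sqrtIter b) atTop (𝓝 (star Y)) :=
      h1.congr fun n => (sqrtIter_selfAdjoint hbs n).star_eq
    exact tendsto_nhds_unique h2 hY
  refine ⟨1 - Y, (IsSelfAdjoint.one _).sub hYs, fun x => ?_, ?_, fun C hC => ?_⟩
  · have h1 : ⟪Y x, x⟫_ℝ ≤ ‖x‖ * ‖x‖ := by
      refine (real_inner_le_norm _ _).trans ?_
      refine mul_le_mul_of_nonneg_right ?_ (norm_nonneg _)
      exact (Y.le_opNorm x).trans (by nlinarith [norm_nonneg x])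
    have h2 : ⟪(1 - Y) x, x⟫_ℝ = ‖x‖ * ‖x‖ - ⟪Y x, x⟫_ℝ := by
      rw [← real_inner_self_eq_norm_mul_norm, ← inner_sub_left]; rfl
    rw [h2]; linarith
  · have h2 : Y + Y = b + Y * Y := by
      have h3 : (2 : ℝ) • Y = (2 : ℝ) • ((1 / 2 : ℝ) • (b + Y * Y)) := congrArg _ hfix
      rw [smul_smul, two_smul] at h3
      rw [h3]; norm_num
    have h4 : (1 - Y) * (1 - Y) = 1 - (Y + Y) + Y * Y := by noncomm_ring
    rw [h4, h2]; abel
  · have hCY : Commute C Y :=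
      tendsto_nhds_unique (tendsto_const_nhds.mul hY)
        ((hY.mul tendsto_const_nhds).congr fun n => (sqrtIter_commute hC n).eq.symm)
    exact (Commute.one_right C).sub_right hCY

theorem norm_one_sub_le {T : H →L[ℝ] H} {c : ℝ} (hc : 0 < c)
    (hpos : ∀ x, c * ‖T x‖ ^ 2 ≤ ⟪T x, x⟫_ℝ) : ‖1 - c • T‖ ≤ 1 := by
  refine ContinuousLinearMap.opNorm_le_bound _ zero_le_one fun x => ?_
  rw [one_mul]
  refine le_of_sq_le_sq ?_ (norm_nonneg x)
  have h1 : (1 - c • T) x = x - c • T x := rfl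
  rw [h1, norm_sub_sq_real, norm_smul, inner_smul_right, real_inner_comm,
    Real.norm_of_nonneg hc.le]
  have h2 := mul_le_mul_of_nonneg_left (hpos x) hc.le
  have h3 : 0 ≤ c * (c * ‖T x‖ ^ 2) := by positivity
  nlinarith

theorem exists_sqrt_bounded [CompleteSpace H] {T : H →L[ℝ] H} (hT : IsSelfAdjoint T) {c : ℝ}
    (hc : 0 < c) (hpos : ∀ x, c * ‖T x‖ ^ 2 ≤ ⟪T x, x⟫_ℝ) :
    ∃ S : H →L[ℝ] H, IsSelfAdjoint S ∧ (∀ x, 0 ≤ ⟪S x, x⟫_ℝ) ∧ S * S = T ∧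
      ∀ C : H →L[ℝ] H, Commute C T → Commute C S := by
  obtain ⟨S, hS, hSp, hSS, hSC⟩ := exists_sqrt_one_sub (norm_one_sub_le hc hpos)
    ((IsSelfAdjoint.one _).sub ((IsSelfAdjoint.all c).smul hT))
  have hsc : 0 < Real.sqrt c := Real.sqrt_pos.2 hc
  refine ⟨(Real.sqrt c)⁻¹ • S, (IsSelfAdjoint.all _).smul hS, fun x => ?_, ?_, fun C hC => ?_⟩
  · have h2 : ⟪((Real.sqrt c)⁻¹ • S) x, x⟫_ℝ = (Real.sqrt c)⁻¹ * ⟪S x, x⟫_ℝ :=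
      real_inner_smul_left _ _ _
    rw [h2]
    exact mul_nonneg (inv_nonneg.2 hsc.le) (hSp x)
  · rw [smul_mul_smul_comm, hSS, sub_sub_cancel, smul_smul, ← mul_inv, Real.mul_self_sqrt hc.le,
      inv_mul_cancel₀ hc.ne', one_smul]
  · exact (hSC C ((Commute.one_right C).sub_right (hC.smul_right c))).smul_right _

/-! ### Self-adjoint operators through their graphs -/

theorem graph_mem_of_forall [CompleteSpace H] {A : H →ₗ.[ℝ] H} (hA : IsSelfAdjoint A) {y z : H}
    (h : ∀ x r, (x, r) ∈ A.graph → ⟪z, x⟫_ℝ = ⟪y, r⟫_ℝ) : (y, z) ∈ A.graph := by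
  have hd := hA.dense_domain
  have h1 : ∀ x : A.domain, ⟪z, (x : H)⟫_ℝ = ⟪y, A x⟫_ℝ := fun x => h _ _ (A.mem_graph x)
  have hy : y ∈ A.adjoint.domain := LinearPMap.mem_adjoint_domain_of_exists y ⟨z, h1⟩
  have h2 : A.adjoint ⟨y, hy⟩ = z := LinearPMap.adjoint_apply_eq hd ⟨y, hy⟩ h1
  have h3 : (y, z) ∈ A.adjoint.graph := by
    rw [← h2]; exact A.adjoint.mem_graph ⟨y, hy⟩
  rwa [LinearPMap.isSelfAdjoint_def.1 hA] at h3

theorem graph_symm [CompleteSpace H] {A : H →ₗ.[ℝ] H} (hA : IsSelfAdjoint A) {x r y s : H}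
    (hx : (x, r) ∈ A.graph) (hy : (y, s) ∈ A.graph) : ⟪r, y⟫_ℝ = ⟪x, s⟫_ℝ := by
  have h := LinearPMap.adjoint_isFormalAdjoint (T := A) hA.dense_domain
  rw [LinearPMap.isSelfAdjoint_def.1 hA] at h
  obtain ⟨x', rfl, rfl⟩ := (LinearPMap.mem_graph_iff A).1 hx
  obtain ⟨y', rfl, rfl⟩ := (LinearPMap.mem_graph_iff A).1 hy
  exact h x' y'

theorem isSelfAdjoint_of_graph [CompleteSpace H] {R : H →ₗ.[ℝ] H}
    (hd : Dense (R.domain : Set H))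
    (h1 : ∀ x r y s, (x, r) ∈ R.graph → (y, s) ∈ R.graph → ⟪r, y⟫_ℝ = ⟪x, s⟫_ℝ)
    (h2 : ∀ y z, (∀ x r, (x, r) ∈ R.graph → ⟪z, x⟫_ℝ = ⟪y, r⟫_ℝ) → (y, z) ∈ R.graph) :
    IsSelfAdjoint R := by
  rw [LinearPMap.isSelfAdjoint_def]
  have hf : R.IsFormalAdjoint R := fun x y => h1 _ _ _ _ (R.mem_graph x) (R.mem_graph y)
  refine le_antisymm (LinearPMap.le_of_le_graph ?_) (hf.le_adjoint hd)
  rintro ⟨y, z⟩ hyz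
  obtain ⟨y', rfl, rfl⟩ := (LinearPMap.mem_graph_iff _).1 hyz
  refine h2 _ _ fun x r hx => ?_
  obtain ⟨x', rfl, rfl⟩ := (LinearPMap.mem_graph_iff _).1 hx
  exact LinearPMap.adjoint_isFormalAdjoint hd y' x'

/-- A bijective self-adjoint operator has a bounded self-adjoint inverse. -/
theorem exists_inverse [CompleteSpace H] {A : H →ₗ.[ℝ] H} (hA : IsSelfAdjoint A)
    (hinj : ∀ x, (x, (0 : H)) ∈ A.graph → x = 0) (hsurj : ∀ y, ∃ x, (x, y) ∈ A.graph) :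
    ∃ T : H →L[ℝ] H, IsSelfAdjoint T ∧ ∀ x y, (x, y) ∈ A.graph ↔ x = T y := by
  choose f hf using hsurj
  have huniq : ∀ x x' y, (x, y) ∈ A.graph → (x', y) ∈ A.graph → x = x' := by
    intro x x' y h h'
    have h3 := A.graph.sub_mem h h'
    rw [Prod.mk_sub_mk, sub_self] at h3
    exact sub_eq_zero.1 (hinj _ h3)
  let F : H →ₗ[ℝ] H :=
    { toFun := f
      map_add' := fun a b => huniq _ _ _ (hf _) (A.graph.add_mem (hf a) (hf b))
      map_smul' := fun c a => huniq _ _ _ (hf _) (A.graph.smul_mem c (hf a)) }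
  have hF : F.IsSymmetric := fun a b => (graph_symm hA (hf a) (hf b)).symm
  refine ⟨⟨F, hF.continuous⟩, ContinuousLinearMap.isSelfAdjoint_iff_isSymmetric.2 hF,
    fun x y => ⟨fun h => huniq _ _ _ h (hf y), ?_⟩⟩
  rintro rfl
  exact hf y

/-- A strictly positive self-adjoint operator is onto. -/
theorem surjective_of_strictlyPositive [CompleteSpace H] {A : H →ₗ.[ℝ] H} (hA : IsSelfAdjoint A)
    {c : ℝ} (hc : 0 < c) (hpos : ∀ x : A.domain, c * ‖(x : H)‖ ^ 2 ≤ ⟪A x, (x : H)⟫_ℝ) (y : H) :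
    ∃ x, (x, y) ∈ A.graph := by
  have hclosed : _root_.IsClosed (A.graph : Set (H × H)) := hA.isClosed
  have : CompleteSpace A.graph := hclosed.completeSpace_coe
  have hlow : ∀ p : A.graph, c * ‖p.1.1‖ ≤ ‖p.1.2‖ := by
    rintro ⟨⟨x, r⟩, hx⟩
    obtain ⟨x', rfl, rfl⟩ := (LinearPMap.mem_graph_iff A).1 hx
    have h1 := (hpos x').trans (real_inner_le_norm _ _)
    rcases (norm_nonneg (x' : H)).eq_or_lt with h0 | h0
    · simp [← h0]
    · simp only
      nlinarith
  let L : A.graph →L[ℝ] H := (ContinuousLinearMap.snd ℝ H H).comp A.graph.subtypeL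
  have hL : AntilipschitzWith (Real.toNNReal (1 + c⁻¹)) L := by
    refine ContinuousLinearMap.antilipschitz_of_bound L fun p => ?_
    have hc' : 0 ≤ 1 + c⁻¹ := by positivity
    rw [Real.coe_toNNReal _ hc']
    have h1 : ‖p‖ = max ‖p.1.1‖ ‖p.1.2‖ := rfl
    have h2 : L p = p.1.2 := rfl
    have h3 : ‖p.1.1‖ ≤ c⁻¹ * ‖p.1.2‖ := by
      rw [le_inv_mul_iff₀ hc]; exact hlow p
    have h4 : 0 ≤ c⁻¹ * ‖p.1.2‖ := by positivity
    rw [h1, h2, add_mul, one_mul]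
    exact max_le (by linarith [norm_nonneg p.1.2]) (by linarith)
  have hrc : _root_.IsClosed (Set.range L) := hL.isClosed_range L.uniformContinuous
  have hrange : LinearMap.range (L : A.graph →ₗ[ℝ] H) = ⊤ := by
    have hcl : _root_.IsClosed ((LinearMap.range (L : A.graph →ₗ[ℝ] H) : Submodule ℝ H) : Set H) := by
      exact hrc
    rw [← hcl.submodule_topologicalClosure_eq, Submodule.topologicalClosure_eq_top_iff,
      Submodule.eq_bot_iff]
    intro z hz
    rw [Submodule.mem_orthogonal] at hz
    have h1 : (z, (0 : H)) ∈ A.graph := by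
      refine graph_mem_of_forall hA fun x r hx => ?_
      have h2 := hz r ⟨⟨(x, r), hx⟩, rfl⟩
      rw [inner_zero_left, real_inner_comm]
      exact h2.symm
    have h3 := hlow ⟨_, h1⟩
    simp only [norm_zero] at h3
    have : ‖z‖ ≤ 0 := by
      by_contra h4
      push Not at h4
      nlinarith
    exact norm_le_zero_iff.1 this
  obtain ⟨p, hp⟩ := LinearMap.range_eq_top.1 hrange y
  refine ⟨p.1.1, ?_⟩
  have h5 : p.1.2 = y := hp
  rw [← h5]
  exact p.2

/-- `R` is the positive square root of `A`: it is self-adjoint, positive, and `R ∘ R = A`,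
domains included. -/
def IsPosSqrt [CompleteSpace H] (R A : H →ₗ.[ℝ] H) : Prop :=
  IsSelfAdjoint R ∧ (∀ x : R.domain, 0 ≤ ⟪R x, (x : H)⟫_ℝ) ∧
    ∀ x y : H, (x, y) ∈ A.graph ↔ ∃ z, (x, z) ∈ R.graph ∧ (z, y) ∈ R.graph

/-- A strictly positive self-adjoint operator has exactly one positive square root. -/
theorem existsUnique_posSqrt [CompleteSpace H] {A : H →ₗ.[ℝ] H} (hA : IsSelfAdjoint A)
    (hpos : ∃ c > 0, ∀ x : A.domain, c * ‖(x : H)‖ ^ 2 ≤ ⟪A x, (x : H)⟫_ℝ) :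
    ∃! R : H →ₗ.[ℝ] H, IsPosSqrt R A := by
  obtain ⟨c, hc, hpos⟩ := hpos
  have hinj : ∀ x, (x, (0 : H)) ∈ A.graph → x = 0 := by
    intro x hx
    obtain ⟨x', rfl, h⟩ := (LinearPMap.mem_graph_iff A).1 hx
    have h1 := hpos x'
    simp only at h
    rw [h, inner_zero_left] at h1
    have h2 : ‖(x' : H)‖ ^ 2 ≤ 0 := by
      by_contra h3
      push Not at h3
      nlinarith
    simpa using h2
  obtain ⟨T, hT, hTA⟩ := exists_inverse hA hinj (surjective_of_strictlyPositive hA hc hpos)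
  have hTpos : ∀ y, c * ‖T y‖ ^ 2 ≤ ⟪T y, y⟫_ℝ := by
    intro y
    obtain ⟨x', hx, hy⟩ := (LinearPMap.mem_graph_iff A).1 ((hTA _ y).2 rfl)
    simp only at hx hy
    have h1 := hpos x'
    rwa [hx, hy, real_inner_comm] at h1
  have hT0 : ∀ y, T y = 0 → y = 0 := by
    intro y hy
    exact LinearPMap.graph_fst_eq_zero_snd A ((hTA _ y).2 rfl) hy
  obtain ⟨S, hS, hSp, hSS, hSC⟩ := exists_sqrt_bounded hT hc hTpos
  have hSST : ∀ y, S (S y) = T y := fun y => by rw [← hSS]; rfl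
  have hS0 : ∀ y, S y = 0 → y = 0 := fun y hy => hT0 y (by rw [← hSST, hy, map_zero])
  have hSsym : ∀ x y, ⟪S x, y⟫_ℝ = ⟪x, S y⟫_ℝ := hS.isSymmetric
  let g : Submodule ℝ (H × H) :=
    LinearMap.range (LinearMap.prod (S : H →ₗ[ℝ] H) LinearMap.id)
  have hg : ∀ x y, (x, y) ∈ g ↔ x = S y := by
    intro x y
    constructor
    · rintro ⟨z, hz⟩
      have h1 : S z = x := congrArg Prod.fst hz
      have h2 : z = y := congrArg Prod.snd hz
      rw [← h1, h2]
    · rintro rfl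
      exact ⟨y, rfl⟩
  have hgr : g.toLinearPMap.graph = g := by
    refine Submodule.toLinearPMap_graph_eq g ?_
    rintro ⟨x, y⟩ hx h0
    have h1 := (hg x y).1 hx
    simp only at h0 ⊢
    exact hS0 y (by rw [← h1, h0])
  have hR : ∀ x y, (x, y) ∈ g.toLinearPMap.graph ↔ x = S y := by
    intro x y; rw [hgr]; exact hg x y
  refine ⟨g.toLinearPMap, ⟨isSelfAdjoint_of_graph ?_ ?_ ?_, ?_, ?_⟩, ?_⟩
  · rw [Submodule.dense_iff_topologicalClosure_eq_top, Submodule.topologicalClosure_eq_top_iff,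
      Submodule.eq_bot_iff]
    intro z hz
    rw [Submodule.mem_orthogonal] at hz
    refine hS0 z ?_
    have h1 : S (S z) ∈ g.toLinearPMap.domain :=
      LinearPMap.mem_domain_of_mem_graph ((hR _ (S z)).2 rfl)
    have h2 := hz _ h1
    rw [hSsym] at h2
    exact inner_self_eq_zero.1 h2
  · intro x r y s hx hy
    rw [(hR x r).1 hx, (hR y s).1 hy, hSsym]
  · intro y z h
    refine (hR y z).2 (ext_inner_right ℝ fun a => ?_)
    rw [hSsym]
    exact (h (S a) a ((hR _ a).2 rfl)).symm
  · intro x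
    have h1 := (hR _ _).1 (g.toLinearPMap.mem_graph x)
    rw [h1, real_inner_comm]
    exact hSp _
  · intro x y
    rw [hTA, ← hSST]
    constructor
    · rintro rfl
      exact ⟨S y, (hR _ _).2 rfl, (hR _ _).2 rfl⟩
    · rintro ⟨z, h1, h2⟩
      rw [(hR _ _).1 h1, (hR _ _).1 h2]
  · rintro R' ⟨hR', hR'p, hR'A⟩
    have hi : ∀ x, (x, (0 : H)) ∈ R'.graph → x = 0 := fun x hx =>
      hinj x ((hR'A x 0).2 ⟨0, hx, R'.graph.zero_mem⟩)
    have hs : ∀ y, ∃ x, (x, y) ∈ R'.graph := fun y => by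
      obtain ⟨z, _, hz⟩ := (hR'A _ y).1 ((hTA _ y).2 rfl)
      exact ⟨z, hz⟩
    obtain ⟨S', hS', hS'R⟩ := exists_inverse hR' hi hs
    have hS'S' : S' * S' = T := by
      ext y
      obtain ⟨z, h1, h2⟩ := (hR'A _ y).1 ((hTA _ y).2 rfl)
      rw [(hS'R _ _).1 h1, (hS'R _ _).1 h2]
      rfl
    have hcomm : Commute S' S := hSC S' (by
      rw [← hS'S']; exact (Commute.refl S').mul_right (Commute.refl S'))
    have hS'p : ∀ y, 0 ≤ ⟪S' y, y⟫_ℝ := by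
      intro y
      obtain ⟨x', hx, hy⟩ := (LinearPMap.mem_graph_iff R').1 ((hS'R _ y).2 rfl)
      simp only at hx hy
      have h1 := hR'p x'
      rwa [hx, hy, real_inner_comm] at h1
    have hSeq : ∀ x, S x = S' x := by
      intro x
      have h1 : (S + S') ((S - S') x) = 0 := by
        have h2 : (S + S') * (S - S') = 0 := by
          rw [← hcomm.symm.mul_self_sub_mul_self_eq, hSS, hS'S', sub_self]
        exact congrArg (fun B : H →L[ℝ] H => B x) h2
      set y := (S - S') x with hy
      have h3 : ⟪S y, y⟫_ℝ + ⟪S' y, y⟫_ℝ = 0 := by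
        rw [← inner_add_left]
        have h4 : S y + S' y = 0 := h1
        rw [h4, inner_zero_left]
      have h5 : ⟪S' y, y⟫_ℝ = 0 := by linarith [hSp y, hS'p y]
      have h6 : ⟪S y, y⟫_ℝ = 0 := by linarith [hSp y, hS'p y]
      have h7 : S y = - S' y := eq_neg_of_add_eq_zero_left h1
      have h8 : y = 0 := by
        refine hS0 y ?_
        set z := S y with hz
        set K := ⟪S z, z⟫_ℝ with hK
        have hK0 : 0 ≤ K := hSp z
        have h9 := hSp ((K + 1) • y - ‖z‖ ^ 2 • z)
        have h10 : ⟪S z, y⟫_ℝ = ‖z‖ ^ 2 := by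
          rw [hSsym, ← hz, real_inner_self_eq_norm_sq]
        simp only [map_sub, map_smul, inner_sub_left, inner_sub_right, inner_smul_left,
          inner_smul_right, ← hz, h6, h10, ← hK, real_inner_self_eq_norm_sq,
          RCLike.conj_to_real] at h9
        have h11 : ‖z‖ ^ 2 * ‖z‖ ^ 2 = 0 := by
          nlinarith [mul_nonneg hK0 (mul_self_nonneg (‖z‖ ^ 2)), mul_self_nonneg (‖z‖ ^ 2)]
        simpa using h11
      rw [hy] at h8
      exact sub_eq_zero.1 h8
    refine LinearPMap.eq_of_eq_graph ?_
    ext ⟨x, y⟩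
    rw [hS'R, hR, hSeq]

open Classical in
/-- The operator `A^{1/2}`: the unique positive square root of `A` (it exists and is unique for
every strictly positive self-adjoint `A`, by `existsUnique_posSqrt`; the value `0` is used when
there is none). -/
def posSqrt [CompleteSpace H] (A : H →ₗ.[ℝ] H) : H →ₗ.[ℝ] H :=
  if h : ∃ R : H →ₗ.[ℝ] H, IsPosSqrt R A then h.choose else 0

theorem isPosSqrt_posSqrt [CompleteSpace H] {A : H →ₗ.[ℝ] H} (hA : IsSelfAdjoint A)
    (hpos : ∃ c > 0, ∀ x : A.domain, c * ‖(x : H)‖ ^ 2 ≤ ⟪A x, (x : H)⟫_ℝ) :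
    IsPosSqrt (posSqrt A) A := by
  have h := (existsUnique_posSqrt hA hpos).exists
  rw [posSqrt, dif_pos h]
  exact h.choose_spec

/-! ### The spectrum and the stability threshold -/

/-- `z` is in the resolvent set of `A`: `A - z` maps `D(A)` bijectively onto `H`, with a bounded
inverse `B`. -/
def InResolventSet (A : H →ₗ.[ℝ] H) (z : ℝ) : Prop :=
  ∃ B : H →L[ℝ] H, (∀ y : H, ∃ h : B y ∈ A.domain, A ⟨B y, h⟩ - z • B y = y) ∧
    ∀ x : A.domain, B (A x - z • (x : H)) = x

/-- The spectrum of the (possibly unbounded) operator `A`. For a self-adjoint operator on a real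
Hilbert space this is the whole spectrum, since the spectrum of the complexification is real. -/
def spectrumSet (A : H →ₗ.[ℝ] H) : Set ℝ := {z | ¬ InResolventSet A z}

/-- The stability threshold `𝔱(κ)`, in terms of `α`, `κ` and `λ₁`. -/
def threshold (α lam₁ κ : ℝ) : ℝ :=
  if κ < α / lam₁ then
    2 * κ / α ^ 2 * (1 - α / (κ * lam₁) + α ^ 2 / (κ ^ 2 * lam₁ ^ 2))
  else 2 * κ / α ^ 2

/-! ### The abstract MGT–Fourier system -/

/-- The phase space `H¹ × H¹ × H × H`, where `H¹ = D(A^{1/2})`. -/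
structure PhaseSpace [CompleteSpace H] (A : H →ₗ.[ℝ] H) where
  /-- the position -/
  u : (posSqrt A).domain
  /-- the velocity `u_t` -/
  v : (posSqrt A).domain
  /-- the acceleration `u_tt` -/
  w : H
  /-- the temperature -/
  θ : H

/-- The energy `½ (‖v + α u‖₁² + ‖w + α v‖² + ‖v‖₁² + ‖θ‖²)`, where `‖x‖₁ = ‖A^{1/2} x‖`. -/
def energy [CompleteSpace H] (A : H →ₗ.[ℝ] H) (α : ℝ) (U : PhaseSpace A) : ℝ :=
  (1 / 2) * (‖posSqrt A (U.v + α • U.u)‖ ^ 2 + ‖U.w + α • (U.v : H)‖ ^ 2 +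
    ‖posSqrt A U.v‖ ^ 2 + ‖U.θ‖ ^ 2)

/-- `U = (u, v, w, θ)`, restricted to `[0, ∞)`, is a weak solution, continuous with values in the
phase space, of
`u_ttt + α u_tt + β A u_t + γ A u = η A θ`, `θ_t + κ A θ = - η A u_tt - α η A u_t`.
The two equations are tested against the elements `φ` of `D(A)`, the operator `A` being moved
onto `φ`. The values of `U` at negative times are irrelevant. -/
structure IsWeakSolution [CompleteSpace H] (A : H →ₗ.[ℝ] H) (α β γ κ η : ℝ)
    (U : ℝ → PhaseSpace A) : Prop where
  continuousOn_u : ContinuousOn (fun t => posSqrt A (U t).u) (Ici 0)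
  continuousOn_v : ContinuousOn (fun t => posSqrt A (U t).v) (Ici 0)
  continuousOn_w : ContinuousOn (fun t => (U t).w) (Ici 0)
  continuousOn_θ : ContinuousOn (fun t => (U t).θ) (Ici 0)
  deriv_u : ∀ t, 0 ≤ t →
    HasDerivWithinAt (fun s => ((U s).u : H)) ((U t).v : H) (Ici 0) t
  deriv_v : ∀ t, 0 ≤ t →
    HasDerivWithinAt (fun s => ((U s).v : H)) (U t).w (Ici 0) t
  deriv_w : ∀ φ : A.domain, ∀ t, 0 ≤ t →
    HasDerivWithinAt (fun s => ⟪(U s).w, (φ : H)⟫_ℝ)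
      (η * ⟪(U t).θ, A φ⟫_ℝ - α * ⟪(U t).w, (φ : H)⟫_ℝ - β * ⟪((U t).v : H), A φ⟫_ℝ
        - γ * ⟪((U t).u : H), A φ⟫_ℝ) (Ici 0) t
  deriv_θ : ∀ φ : A.domain, ∀ t, 0 ≤ t →
    HasDerivWithinAt (fun s => ⟪(U s).θ, (φ : H)⟫_ℝ)
      (-(κ * ⟪(U t).θ, A φ⟫_ℝ) - η * ⟪(U t).w, A φ⟫_ℝ - α * η * ⟪((U t).v : H), A φ⟫_ℝ)
      (Ici 0) t

/-- `S` is the solution semigroup of the system: for every initial datum `U₀` the map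
`t ↦ S t U₀` is the unique weak solution on `[0, ∞)` that starts from `U₀`. -/
structure IsSolutionSemigroup [CompleteSpace H] (A : H →ₗ.[ℝ] H) (α β γ κ η : ℝ)
    (S : ℝ → PhaseSpace A → PhaseSpace A) : Prop where
  initial : ∀ U₀, S 0 U₀ = U₀
  isWeakSolution : ∀ U₀, IsWeakSolution A α β γ κ η (fun t => S t U₀)
  unique : ∀ U : ℝ → PhaseSpace A, IsWeakSolution A α β γ κ η U →
    ∀ t, 0 ≤ t → U t = S t (U 0)

/-- The system has a solution semigroup and its energy decays exponentially, uniformly with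
respect to the initial data. -/
def ExponentiallyStable [CompleteSpace H] (A : H →ₗ.[ℝ] H) (α β γ κ η : ℝ) : Prop :=
  ∃ S : ℝ → PhaseSpace A → PhaseSpace A, IsSolutionSemigroup A α β γ κ η S ∧
    ∃ M ω : ℝ, 1 ≤ M ∧ 0 < ω ∧ ∀ U₀ : PhaseSpace A, ∀ t, 0 ≤ t →
      energy A α (S t U₀) ≤ M * energy A α U₀ * Real.exp (-ω * t)

end MGTFourier

end

namespace MGTFourier

open scoped InnerProductSpace Topology
open Set Filter

variable {H : Type*} [NormedAddCommGroup H] [InnerProductSpace ℝ H]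

/-! ### The Lyapunov functional -/

/-! Write μ = γ - αβ, S = A^{-1/2}, b = p - αa = A^{1/2}v and k = A^{1/2}θ. The natural energy
½(‖ζ‖² + ‖θ‖² + (γ/α)‖p‖² - (μ/α)‖b‖²) has derivative μ‖b‖² - κ‖k‖²: for μ > 0 the mechanical part
is antidissipative. The coupling repairs this. In b' and in η⁻¹Sθ' the term A^{1/2}ζ occurs with
opposite signs, so (η⁻¹Sθ + b)' = -((κ/η)k + αb). Adding (μ/α)‖η⁻¹Sθ + b‖² to the energy turns
+μ‖b‖² into -μ‖b‖², up to cross terms. Completing the square (`coreFunctional_dissipation`) leaves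
an error (μ/η²)(‖A⁻¹k‖² + (κ²/α²)‖k‖²), which the heat dissipation κ‖k‖² absorbs when μ(λ₁⁻² +
κ²/α²) < κη². This follows from η² > 𝔱(κ)μ (`threshold_condition`).

The core functional need not control a, and its derivative dissipates only k and μ‖b‖². A small
multiple of `crossFunctional` supplies the rest, giving a strict Lyapunov functional equivalent to
the square of the norm (`exists_lyapunov`). Its constants depend on S only through an upper bound s
for ‖S‖.

This uniformity makes one a priori estimate, `exists_uniform_decay`, serve for everything. Replacing
A^{1/2} by the bounded operators (S + ε)⁻¹ gives uniformly bounded groups that decay at a common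
rate; by Duhamel's formula they converge strongly, and the limit is the decaying semigroup
(`exists_decaying_semigroup`). Applied to A⁻¹ times the difference of two weak solutions, which is
regular enough, the same estimate gives uniqueness (`eq_of_regularized_solutions`).

The bound ‖S‖² ≤ 1/λ₁ is obtained without the spectral theorem: a lower bound of the form of A that
lies in the resolvent set can be increased, so λ₁ itself is a lower bound. -/

/-- The part of the Lyapunov functional that dissipates `‖A^{1/2} θ‖²`, in the coordinates
`p = A^{1/2}(v + α u)`, `a = A^{1/2} u`, `ζ = w + α v`, `θ`; here `S = A^{-1/2}`. -/
noncomputable def coreFunctional (S : H →L[ℝ] H) (α γ μ η : ℝ) (p a ζ θ : H) : ℝ :=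
  1 / 2 * (‖ζ‖ ^ 2 + ‖θ‖ ^ 2 + γ / α * ‖p‖ ^ 2 - μ / α * ‖p - α • a‖ ^ 2) +
    μ / α * ‖η⁻¹ • S θ + (p - α • a)‖ ^ 2

/-- The correction that recovers the dissipation of `p`, `a` and `ζ`. -/
noncomputable def crossFunctional (S : H →L[ℝ] H) (γ η : ℝ) (p a ζ θ : H) : ℝ :=
  4 / η * ⟪S (S θ), ζ⟫_ℝ + ⟪S p, ζ⟫_ℝ + γ / 8 * ‖a‖ ^ 2

/-! ### Time derivatives of the two functionals. -/

section Derivatives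

variable {α β γ κ η μ : ℝ} {S : H →L[ℝ] H} {p a ζ θ : ℝ → H} {g h q r : H} {t : ℝ} {s : Set ℝ}

/-- The vectors g, h, q, r stand for Aζ, Aθ, A^{1/2}p, A^{1/2}a at time t. With this reading the
hypotheses are the system itself, and only the bounded operator S occurs. -/
theorem hasDerivWithinAt_coreFunctional
    (hp : HasDerivWithinAt p (S g) s t) (ha : HasDerivWithinAt a (p t - α • a t) s t)
    (hζ : HasDerivWithinAt ζ (η • h - β • q - μ • r) s t)
    (hθ : HasDerivWithinAt θ (-(κ • h) - η • g) s t) :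
    HasDerivWithinAt (fun x => coreFunctional S α γ μ η (p x) (a x) (ζ x) (θ x))
      (⟪ζ t, η • h - β • q - μ • r⟫_ℝ + ⟪θ t, -(κ • h) - η • g⟫_ℝ + γ / α * ⟪p t, S g⟫_ℝ
        - μ / α * ⟪p t - α • a t, S g - α • (p t - α • a t)⟫_ℝ
        + 2 * μ / α * ⟪η⁻¹ • S (θ t) + (p t - α • a t),
            η⁻¹ • S (-(κ • h) - η • g) + (S g - α • (p t - α • a t))⟫_ℝ) s t := by
  have hb := hp.sub (ha.const_smul α)
  have hS := (S.hasFDerivAt.comp_hasDerivWithinAt t hθ).const_smul η⁻¹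
  have h1 := ((((hζ.norm_sq.add hθ.norm_sq).add (hp.norm_sq.const_mul (γ / α))).sub
    (hb.norm_sq.const_mul (μ / α))).const_mul (1 / 2)).add
      ((hS.add hb).norm_sq.const_mul (μ / α))
  refine h1.congr_deriv ?_
  simp only [Pi.add_apply, Pi.sub_apply, Pi.smul_apply, Function.comp_apply]
  ring

theorem hasDerivWithinAt_crossFunctional
    (hp : HasDerivWithinAt p (S g) s t) (ha : HasDerivWithinAt a (p t - α • a t) s t)
    (hζ : HasDerivWithinAt ζ (η • h - β • q - μ • r) s t)
    (hθ : HasDerivWithinAt θ (-(κ • h) - η • g) s t) :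
    HasDerivWithinAt (fun x => crossFunctional S γ η (p x) (a x) (ζ x) (θ x))
      (4 / η * (⟪S (S (θ t)), η • h - β • q - μ • r⟫_ℝ + ⟪S (S (-(κ • h) - η • g)), ζ t⟫_ℝ)
        + (⟪S (p t), η • h - β • q - μ • r⟫_ℝ + ⟪S (S g), ζ t⟫_ℝ)
        + γ / 8 * (2 * ⟪a t, p t - α • a t⟫_ℝ)) s t := by
  have hSθ := S.hasFDerivAt.comp_hasDerivWithinAt t (S.hasFDerivAt.comp_hasDerivWithinAt t hθ)
  have hSp := S.hasFDerivAt.comp_hasDerivWithinAt t hp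
  exact (((hSθ.inner ℝ hζ).const_mul (4 / η)).add (hSp.inner ℝ hζ)).add
    (ha.norm_sq.const_mul (γ / 8))

end Derivatives

/-! ### The exact dissipation identity. -/

section Dissipation

variable {α β γ κ η s : ℝ} {S : H →L[ℝ] H}

/-- All terms in S g = A^{1/2}ζ cancel, because γ/α = β + μ/α. What remains is quadratic in b, k and
S(Sk), and completing the square in b also removes the product ⟨S(Sk), k⟩. -/
theorem coreFunctional_dissipation (hα : 0 < α) (hη : η ≠ 0)
    (hS : ∀ x y, ⟪S x, y⟫_ℝ = ⟪x, S y⟫_ℝ) (g h q r : H) :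
    let μ := γ - α * β
    let k := S h
    let b := S q - α • S r
    ⟪S (S g), η • h - β • q - μ • r⟫_ℝ + ⟪S k, -(κ • h) - η • g⟫_ℝ + γ / α * ⟪S q, S g⟫_ℝ
        - μ / α * ⟪b, S g - α • b⟫_ℝ
        + 2 * μ / α * ⟪η⁻¹ • S (S k) + b, η⁻¹ • S (-(κ • h) - η • g) + (S g - α • b)⟫_ℝ
      = -(κ * ‖k‖ ^ 2) + μ / η ^ 2 * (‖S (S k)‖ ^ 2 + κ ^ 2 / α ^ 2 * ‖k‖ ^ 2)
        - μ * ‖b + (η⁻¹ • S (S k) + (κ / (α * η)) • k)‖ ^ 2 := by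
  intro μ k b
  have hq : S q = b + α • S r := by simp [b]
  have e1 : ⟪S (S g), η • h - β • q - μ • r⟫_ℝ
      = η * ⟪S g, k⟫_ℝ - β * ⟪S g, b⟫_ℝ - (α * β + μ) * ⟪S g, S r⟫_ℝ := by
    rw [hS, map_sub, map_sub, map_smul, map_smul, map_smul, hq]
    simp only [inner_sub_right, inner_smul_right, inner_add_right]
    ring
  have e2 : ⟪S k, -(κ • h) - η • g⟫_ℝ = -(κ * ‖k‖ ^ 2) - η * ⟪S g, k⟫_ℝ := by
    rw [hS, map_sub, map_neg, map_smul, map_smul]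
    simp only [inner_sub_right, inner_smul_right, inner_neg_right, real_inner_self_eq_norm_sq, k,
      real_inner_comm (S g)]
  -- The cancellation behind the corrector: η⁻¹S(-ηg) removes the S g coming from b'.
  have e3 : η⁻¹ • S (-(κ • h) - η • g) + (S g - α • b) = -((κ / η) • k + α • b) := by
    rw [map_sub, map_neg, map_smul, map_smul, smul_sub, smul_smul, smul_neg, smul_smul,
      inv_mul_cancel₀ hη, one_smul, div_eq_inv_mul]
    abel
  rw [e1, e2, e3, hq]
  simp only [← real_inner_self_eq_norm_sq, inner_add_left, inner_add_right, inner_sub_right,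
    inner_smul_left, inner_smul_right, inner_neg_right, RCLike.conj_to_real]
  rw [real_inner_comm b (S g), real_inner_comm (S r) (S g), real_inner_comm (S (S k)) b,
    real_inner_comm k b, real_inner_comm (S (S k)) k]
  simp only [μ]
  field_simp
  ring

end Dissipation

/-! ### Quantitative dissipation estimates. -/

section Bounds

variable {α β γ κ η s : ℝ}

theorem norm_apply_apply_le {S : H →L[ℝ] H} (hs : 0 ≤ s) (hSs : ∀ x, ‖S x‖ ≤ s * ‖x‖) (x : H) :
    ‖S (S x)‖ ≤ s ^ 2 * ‖x‖ :=
  (hSs _).trans (by nlinarith [mul_le_mul_of_nonneg_left (hSs x) hs])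

/-- The strict inequality `hcond` leaves a margin ε‖k‖². As the shift n in the square satisfies ‖n‖
≤ m‖k‖, part of this margin, with half of μ‖b + n‖², pays for a multiple of μ‖b‖². -/
theorem exists_core_dissipation_rate (hα : 0 < α) (hη : η ≠ 0) (hκ : 0 < κ) (hs : 0 ≤ s)
    (hμ : 0 ≤ γ - α * β)
    (hcond : (γ - α * β) * (s ^ 4 + κ ^ 2 / α ^ 2) < κ * η ^ 2) :
    ∃ c > 0, ∀ S : H →L[ℝ] H, (∀ x, ‖S x‖ ≤ s * ‖x‖) → ∀ k b : H,
      -(κ * ‖k‖ ^ 2) + (γ - α * β) / η ^ 2 * (‖S (S k)‖ ^ 2 + κ ^ 2 / α ^ 2 * ‖k‖ ^ 2)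
        - (γ - α * β) * ‖b + (η⁻¹ • S (S k) + (κ / (α * η)) • k)‖ ^ 2
      ≤ -(c * (‖k‖ ^ 2 + (γ - α * β) * ‖b‖ ^ 2)) := by
  set μ := γ - α * β
  have hη2 : 0 < η ^ 2 := by positivity
  set ε := κ - μ / η ^ 2 * (s ^ 4 + κ ^ 2 / α ^ 2) with hε
  have hε0 : 0 < ε := by
    rw [hε, sub_pos, div_mul_eq_mul_div, div_lt_iff₀ hη2]; exact hcond
  set m := |η⁻¹| * s ^ 2 + |κ / (α * η)| with hm
  have hm0 : 0 ≤ m := by positivity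
  have hden : 0 < 1 + 2 * μ * m ^ 2 := by positivity
  obtain ⟨c, hc0, hc1, hc2⟩ : ∃ c > 0, c ≤ 1 / 2 ∧ c * (1 + 2 * μ * m ^ 2) ≤ ε :=
    ⟨min (1 / 2) (ε / (1 + 2 * μ * m ^ 2)), lt_min (by norm_num) (by positivity),
      min_le_left _ _, (le_div_iff₀ hden).1 (min_le_right _ _)⟩
  refine ⟨c, hc0, ?_⟩
  intro S hSs k b
  have hTk := norm_apply_apply_le hs hSs k
  set n := η⁻¹ • S (S k) + (κ / (α * η)) • k with hn
  have hnb : ‖n‖ ≤ m * ‖k‖ := by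
    rw [hn]
    refine (norm_add_le _ _).trans ?_
    rw [norm_smul, norm_smul, Real.norm_eq_abs, Real.norm_eq_abs, hm, add_mul, mul_assoc]
    gcongr
  have hTk2 : ‖S (S k)‖ ^ 2 ≤ s ^ 4 * ‖k‖ ^ 2 := by
    have := pow_le_pow_left₀ (norm_nonneg _) hTk 2
    nlinarith
  have hn2 : ‖n‖ ^ 2 ≤ m ^ 2 * ‖k‖ ^ 2 := by
    have := pow_le_pow_left₀ (norm_nonneg _) hnb 2
    nlinarith
  have hb2 : ‖b‖ ^ 2 ≤ 2 * ‖b + n‖ ^ 2 + 2 * ‖n‖ ^ 2 := by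
    have h1 : ‖b‖ ≤ ‖b + n‖ + ‖n‖ := by simpa using norm_sub_le (b + n) n
    have h2 := pow_le_pow_left₀ (norm_nonneg _) h1 2
    nlinarith [sq_nonneg (‖b + n‖ - ‖n‖)]
  have h1 : μ / η ^ 2 * (‖S (S k)‖ ^ 2 + κ ^ 2 / α ^ 2 * ‖k‖ ^ 2)
      ≤ (κ - ε) * ‖k‖ ^ 2 := by
    have : (κ - ε) * ‖k‖ ^ 2
        = μ / η ^ 2 * (s ^ 4 * ‖k‖ ^ 2 + κ ^ 2 / α ^ 2 * ‖k‖ ^ 2) := by rw [hε]; ring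
    rw [this]
    gcongr
  have h2 : c * (μ * ‖b‖ ^ 2) ≤ c * (μ * (2 * ‖b + n‖ ^ 2 + 2 * (m ^ 2 * ‖k‖ ^ 2))) := by
    gcongr
    linarith
  have h3 : c * (μ * (2 * ‖b + n‖ ^ 2)) ≤ μ * ‖b + n‖ ^ 2 := by
    have := mul_le_mul_of_nonneg_right hc1 (mul_nonneg hμ (sq_nonneg ‖b + n‖))
    linarith
  have h4 := mul_le_mul_of_nonneg_right hc2 (sq_nonneg ‖k‖)
  linarith

theorem mul_le_sq_add_sq {x y e : ℝ} (he : 0 < e) : x * y ≤ e * y ^ 2 + x ^ 2 / (4 * e) := by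
  have h : e * y ^ 2 + x ^ 2 / (4 * e) - x * y = (2 * e * y - x) ^ 2 / (4 * e) := by
    field_simp; ring
  have : 0 ≤ (2 * e * y - x) ^ 2 / (4 * e) := by positivity
  linarith

theorem mul_inner_le (d : ℝ) {e : ℝ} (he : 0 < e) (x y : H) :
    d * ⟪x, y⟫_ℝ ≤ e * ‖y‖ ^ 2 + d ^ 2 / (4 * e) * ‖x‖ ^ 2 := by
  have h1 : d * ⟪x, y⟫_ℝ ≤ (|d| * ‖x‖) * ‖y‖ := by
    refine (le_abs_self _).trans ?_
    rw [abs_mul, mul_assoc]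
    gcongr
    exact abs_real_inner_le_norm x y
  have h2 := mul_le_sq_add_sq (x := |d| * ‖x‖) (y := ‖y‖) he
  have h3 : (|d| * ‖x‖) ^ 2 / (4 * e) = d ^ 2 / (4 * e) * ‖x‖ ^ 2 := by
    rw [mul_pow, sq_abs]; ring
  linarith

/-- Each summand of the cross functional produces one missing term: ⟨S²θ, ζ⟩ gives -‖ζ‖² through the
coupling, ⟨Sp, ζ⟩ gives -‖p‖² through the elastic force, and ‖a‖² gives -‖a‖² from a' = p - αa. The
factor 4 outweighs the +‖ζ‖² caused by ⟨Sp, ζ⟩. -/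
theorem exists_cross_dissipation (hα : 0 < α) (hη : η ≠ 0) (hγ : 0 < γ)
    (hs : 0 ≤ s) (hμ : 0 ≤ γ - α * β) :
    ∃ C > 0, ∀ S : H →L[ℝ] H, (∀ x y, ⟪S x, y⟫_ℝ = ⟪x, S y⟫_ℝ) → (∀ x, ‖S x‖ ≤ s * ‖x‖) →
      ∀ g h q r : H,
      let μ := γ - α * β
      let k := S h
      let p := S q
      let a := S r
      let ζ := S (S g)
      4 / η * (⟪S (S (S k)), η • h - β • q - μ • r⟫_ℝ + ⟪S (S (-(κ • h) - η • g)), ζ⟫_ℝ)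
        + (⟪S p, η • h - β • q - μ • r⟫_ℝ + ⟪S (S g), ζ⟫_ℝ)
        + γ / 8 * (2 * ⟪a, p - α • a⟫_ℝ)
      ≤ -‖ζ‖ ^ 2 - 3 * γ / (8 * α) * ‖p‖ ^ 2 - α * γ / 8 * ‖a‖ ^ 2
        + C * (‖k‖ ^ 2 + μ * ‖p - α • a‖ ^ 2) := by
  set μ := γ - α * β with hμd
  set C₁ := 4 * s ^ 2 + (4 * κ / η) ^ 2 / 8 * s ^ 2 +
    (4 * γ / (η * α)) ^ 2 / (4 * (γ / (4 * α))) * s ^ 4 + 4 / (η * α) ^ 2 * μ * s ^ 4 +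
    η ^ 2 / (4 * (γ / (8 * α)))
  set C₂ := 1 + 1 / α ^ 2 / (4 * (γ / (8 * α))) * μ
  have hC₁ : 0 ≤ C₁ := by positivity
  have hC₂ : 0 ≤ C₂ := by positivity
  refine ⟨C₁ + C₂ + 1, by positivity, ?_⟩
  intro S hS hSs g h q r μ' k p a ζ
  set b := p - α • a with hb
  set f := S (S k) with hf
  have hfn : ‖f‖ ^ 2 ≤ s ^ 4 * ‖k‖ ^ 2 := by
    have := pow_le_pow_left₀ (norm_nonneg _) (norm_apply_apply_le hs hSs k) 2
    nlinarith
  have hkn : ‖S k‖ ^ 2 ≤ s ^ 2 * ‖k‖ ^ 2 := by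
    have := pow_le_pow_left₀ (norm_nonneg _) (hSs k) 2
    nlinarith
  -- The force is written in p and b instead of p and a, since μ‖b‖² is already dissipated by the
  -- core functional.
  have hpa : β • p + μ • a = (γ / α) • p - (μ / α) • b := by
    have hγ' : γ / α = β + μ / α := by rw [hμd]; field_simp; ring
    rw [hb, hγ', add_smul, smul_sub, smul_smul, div_mul_cancel₀ _ hα.ne']
    abel
  have hforce : S (η • h - β • q - μ • r) = η • k - ((γ / α) • p - (μ / α) • b) := by
    rw [← hpa, map_sub, map_sub, map_smul, map_smul, map_smul, sub_sub]
  have e1 : ⟪S (S (S k)), η • h - β • q - μ • r⟫_ℝ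
      = η * ‖S k‖ ^ 2 - γ / α * ⟪f, p⟫_ℝ + μ / α * ⟪f, b⟫_ℝ := by
    rw [hS, hforce]
    simp only [inner_sub_right, inner_smul_right, ← hf]
    have : ⟪f, k⟫_ℝ = ‖S k‖ ^ 2 := by rw [hf, hS, real_inner_self_eq_norm_sq]
    rw [this]; ring
  have e2 : ⟪S (S (-(κ • h) - η • g)), ζ⟫_ℝ = -(κ * ⟪S k, ζ⟫_ℝ) - η * ‖ζ‖ ^ 2 := by
    simp only [map_sub, map_neg, map_smul, inner_sub_left, inner_neg_left, real_inner_smul_left]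
    rw [← real_inner_self_eq_norm_sq]
  have e3 : ⟪S p, η • h - β • q - μ • r⟫_ℝ
      = η * ⟪k, p⟫_ℝ - γ / α * ‖p‖ ^ 2 + μ / α * ⟪b, p⟫_ℝ := by
    rw [hS, hforce]
    simp only [inner_sub_right, inner_smul_right, real_inner_self_eq_norm_sq]
    rw [real_inner_comm k p, real_inner_comm b p]; ring
  have e4 : ⟪S (S g), ζ⟫_ℝ = ‖ζ‖ ^ 2 := real_inner_self_eq_norm_sq ζ
  have e5 : ⟪a, b⟫_ℝ = ⟪p, a⟫_ℝ - α * ‖a‖ ^ 2 := by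
    rw [hb, inner_sub_right, inner_smul_right, real_inner_self_eq_norm_sq, real_inner_comm]
  have hμμ : μ' = μ := rfl
  rw [hμμ, e1, e2, e3, e4, e5]
  -- Young's inequality with a fixed budget. For ‖ζ‖²: -4 + 1 + 2 = -1. For ‖p‖², in units of
  -- γ/(8α): -8 + 2 + 1 + 1 + 1 = -3. For ‖a‖²: -αγ/4 + αγ/8. The remainders are multiples of ‖k‖²
  -- and μ‖b‖².
  have i1 := mul_inner_le (-(4 * κ / η)) (by norm_num : (0 : ℝ) < 2) (S k) ζ
  have i2 := mul_inner_le (-(4 * γ / (η * α))) (by positivity : 0 < γ / (4 * α)) f p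
  have i3 := mul_inner_le (4 / (η * α)) (by norm_num : (0 : ℝ) < 1) f b
  have i4 := mul_inner_le η (by positivity : 0 < γ / (8 * α)) k p
  have i5 := mul_inner_le (μ / α) (by positivity : 0 < γ / (8 * α)) b p
  have i6 := mul_inner_le (γ / 4) (by positivity : 0 < α * γ / 8) p a
  have j3 := mul_le_mul_of_nonneg_left i3 hμ
  have hcoef : (γ / 4) ^ 2 / (4 * (α * γ / 8)) = γ / (8 * α) := by field_simp; ring
  rw [hcoef] at i6
  have hsplit : 4 / η * (η * ‖S k‖ ^ 2 - γ / α * ⟪f, p⟫_ℝ + μ / α * ⟪f, b⟫_ℝ +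
      (-(κ * ⟪S k, ζ⟫_ℝ) - η * ‖ζ‖ ^ 2)) = 4 * ‖S k‖ ^ 2 + -(4 * γ / (η * α)) * ⟪f, p⟫_ℝ
        + μ * (4 / (η * α) * ⟪f, b⟫_ℝ) + -(4 * κ / η) * ⟪S k, ζ⟫_ℝ - 4 * ‖ζ‖ ^ 2 := by
    field_simp
    ring
  rw [hsplit]
  have f1 : (-(4 * γ / (η * α))) ^ 2 / (4 * (γ / (4 * α))) * ‖f‖ ^ 2
      ≤ (4 * γ / (η * α)) ^ 2 / (4 * (γ / (4 * α))) * (s ^ 4 * ‖k‖ ^ 2) := by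
    rw [neg_sq]; gcongr
  have f2 : μ * ((4 / (η * α)) ^ 2 / (4 * 1) * ‖f‖ ^ 2)
      ≤ 4 / (η * α) ^ 2 * μ * (s ^ 4 * ‖k‖ ^ 2) := by
    have : μ * ((4 / (η * α)) ^ 2 / (4 * 1) * ‖f‖ ^ 2) = 4 / (η * α) ^ 2 * μ * ‖f‖ ^ 2 := by
      ring
    rw [this]; gcongr
  have f3 : (-(4 * κ / η)) ^ 2 / (4 * 2) * ‖S k‖ ^ 2
      ≤ (4 * κ / η) ^ 2 / 8 * (s ^ 2 * ‖k‖ ^ 2) := by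
    have : (4 : ℝ) * 2 = 8 := by norm_num
    rw [neg_sq, this]; gcongr
  have f4 : (μ / α) ^ 2 / (4 * (γ / (8 * α))) * ‖b‖ ^ 2
      = 1 / α ^ 2 / (4 * (γ / (8 * α))) * μ * (μ * ‖b‖ ^ 2) := by ring
  have hK : 0 ≤ ‖k‖ ^ 2 := sq_nonneg _
  have hB : 0 ≤ μ * ‖b‖ ^ 2 := by positivity
  have g1 : 4 * ‖S k‖ ^ 2 + (4 * κ / η) ^ 2 / 8 * (s ^ 2 * ‖k‖ ^ 2)
      + (4 * γ / (η * α)) ^ 2 / (4 * (γ / (4 * α))) * (s ^ 4 * ‖k‖ ^ 2)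
      + 4 / (η * α) ^ 2 * μ * (s ^ 4 * ‖k‖ ^ 2)
      + η ^ 2 / (4 * (γ / (8 * α))) * ‖k‖ ^ 2 ≤ C₁ * ‖k‖ ^ 2 := by
    have : C₁ * ‖k‖ ^ 2 = 4 * (s ^ 2 * ‖k‖ ^ 2) + (4 * κ / η) ^ 2 / 8 * (s ^ 2 * ‖k‖ ^ 2)
      + (4 * γ / (η * α)) ^ 2 / (4 * (γ / (4 * α))) * (s ^ 4 * ‖k‖ ^ 2)
      + 4 / (η * α) ^ 2 * μ * (s ^ 4 * ‖k‖ ^ 2)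
      + η ^ 2 / (4 * (γ / (8 * α))) * ‖k‖ ^ 2 := by ring
    rw [this]; gcongr
  have g2 : μ * ‖b‖ ^ 2 + 1 / α ^ 2 / (4 * (γ / (8 * α))) * μ * (μ * ‖b‖ ^ 2)
      = C₂ * (μ * ‖b‖ ^ 2) := by ring
  have g3 : C₁ * ‖k‖ ^ 2 + C₂ * (μ * ‖b‖ ^ 2)
      ≤ (C₁ + C₂ + 1) * (‖k‖ ^ 2 + μ * ‖b‖ ^ 2) := by
    have x1 := mul_nonneg hC₁ hB
    have x2 := mul_nonneg hC₂ hK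
    linarith
  have g4 : γ / α * ‖p‖ ^ 2 = 8 * (γ / (8 * α) * ‖p‖ ^ 2) := by field_simp
  have g5 : γ / (4 * α) * ‖p‖ ^ 2 = 2 * (γ / (8 * α) * ‖p‖ ^ 2) := by field_simp; ring
  have g6 : 3 * γ / (8 * α) * ‖p‖ ^ 2 = 3 * (γ / (8 * α) * ‖p‖ ^ 2) := by ring
  rw [g4, g6]
  rw [g5] at i2
  rw [f4] at i5
  linarith

end Bounds

/-- The square of the Hilbert norm of the state `(p, a, ζ, θ)`. -/
def sqNorm {E : Type*} [NormedAddCommGroup E] (p a ζ θ : E) : ℝ :=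
  ‖p‖ ^ 2 + ‖a‖ ^ 2 + ‖ζ‖ ^ 2 + ‖θ‖ ^ 2

theorem sqNorm_nonneg {E : Type*} [NormedAddCommGroup E] (p a ζ θ : E) : 0 ≤ sqNorm p a ζ θ := by
  unfold sqNorm; positivity

theorem norm_sub_sq_le {E : Type*} [NormedAddCommGroup E] (x y : E) :
    ‖x - y‖ ^ 2 ≤ 2 * ‖x‖ ^ 2 + 2 * ‖y‖ ^ 2 := by
  have h2 := pow_le_pow_left₀ (norm_nonneg _) (norm_sub_le x y) 2
  nlinarith [sq_nonneg (‖x‖ - ‖y‖)]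

/-! ### The Lyapunov inequality and uniform exponential decay. -/

section Lyapunov

variable {α β γ κ η s : ℝ}

theorem norm_apply_sq_le {S : H →L[ℝ] H} (hSs : ∀ x, ‖S x‖ ≤ s * ‖x‖) (x : H) :
    ‖S x‖ ^ 2 ≤ s ^ 2 * ‖x‖ ^ 2 := by
  rw [← mul_pow]
  exact pow_le_pow_left₀ (norm_nonneg _) (hSs x) 2

theorem norm_apply_apply_sq_le {S : H →L[ℝ] H} (hs : 0 ≤ s) (hSs : ∀ x, ‖S x‖ ≤ s * ‖x‖) (x : H) :
    ‖S (S x)‖ ^ 2 ≤ s ^ 4 * ‖x‖ ^ 2 := by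
  have := pow_le_pow_left₀ (norm_nonneg _) (norm_apply_apply_le hs hSs x) 2
  rwa [mul_pow, ← pow_mul] at this

/-- With f = η⁻¹Sθ, the bound ‖b‖² ≤ 2‖f + b‖² + 2‖f‖² lets the corrector absorb the negative term
at the cost of (μ/α)‖f‖², a multiple of ‖θ‖². The variable a is not controlled: it is absent from
the functional when μ = 0. -/
theorem coreFunctional_coercive (hα : 0 < α) (hη : η ≠ 0) (hκ : 0 < κ) (hγ : 0 < γ) {μ : ℝ}
    (hμ : 0 ≤ μ) (hcond : μ * (s ^ 4 + κ ^ 2 / α ^ 2) < κ * η ^ 2) :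
    ∃ m > 0, ∀ S : H →L[ℝ] H, (∀ x, ‖S x‖ ≤ s * ‖x‖) → ∀ p a ζ θ : H,
      m * (‖p‖ ^ 2 + ‖ζ‖ ^ 2 + ‖θ‖ ^ 2) ≤ coreFunctional S α γ μ η p a ζ θ := by
  have hη2 : 0 < η ^ 2 := by positivity
  have hd : 0 < 1 / 2 - μ * s ^ 2 / (α * η ^ 2) := by
    rw [sub_pos, div_lt_iff₀ (by positivity)]
    -- By the arithmetic-geometric mean inequality the dissipation condition already contains 2μs²/α
    -- < η², which is what coercivity needs.
    have h1 : 2 * (s ^ 2 * (κ / α)) ≤ s ^ 4 + κ ^ 2 / α ^ 2 := by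
      rw [← div_pow]; nlinarith [sq_nonneg (s ^ 2 - κ / α)]
    have h2 : μ * (2 * (s ^ 2 * (κ / α))) < κ * η ^ 2 :=
      (mul_le_mul_of_nonneg_left h1 hμ).trans_lt hcond
    have h3 : μ * (2 * (s ^ 2 * (κ / α))) = κ * (2 * μ * s ^ 2 / α) := by ring
    rw [h3] at h2
    have h4 := lt_of_mul_lt_mul_left h2 hκ.le
    rw [div_lt_iff₀ hα] at h4
    linarith
  set d := 1 / 2 - μ * s ^ 2 / (α * η ^ 2) with hdd
  obtain ⟨m, hm, hm1, hm2, hm3⟩ : ∃ m > 0, m ≤ 1 / 2 ∧ m ≤ d ∧ m ≤ γ / (2 * α) :=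
    ⟨min (1 / 2) (min d (γ / (2 * α))), by positivity, min_le_left _ _,
      (min_le_right _ _).trans (min_le_left _ _), (min_le_right _ _).trans (min_le_right _ _)⟩
  refine ⟨m, hm, fun S hSs p a ζ θ => ?_⟩
  unfold coreFunctional
  set b := p - α • a
  set f := η⁻¹ • S θ with hf
  have hb : ‖b‖ ^ 2 ≤ 2 * ‖f + b‖ ^ 2 + 2 * ‖f‖ ^ 2 := by
    simpa using norm_sub_sq_le (f + b) f
  have hfn : ‖f‖ ^ 2 ≤ s ^ 2 / η ^ 2 * ‖θ‖ ^ 2 := by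
    rw [hf, norm_smul, mul_pow, Real.norm_eq_abs, sq_abs, inv_pow, div_eq_inv_mul, mul_assoc]
    exact mul_le_mul_of_nonneg_left (norm_apply_sq_le hSs θ) (by positivity)
  have h1 : μ / α * ‖b‖ ^ 2
      ≤ μ / α * (2 * ‖f + b‖ ^ 2 + 2 * (s ^ 2 / η ^ 2 * ‖θ‖ ^ 2)) := by
    gcongr
    linarith
  have h2 : d * ‖θ‖ ^ 2 = 1 / 2 * ‖θ‖ ^ 2 - μ / α * (s ^ 2 / η ^ 2 * ‖θ‖ ^ 2) := by
    rw [hdd]; ring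
  have h3 : γ / (2 * α) * ‖p‖ ^ 2 = 1 / 2 * (γ / α * ‖p‖ ^ 2) := by ring
  have k1 := mul_le_mul_of_nonneg_right hm1 (sq_nonneg ‖ζ‖)
  have k2 := mul_le_mul_of_nonneg_right hm2 (sq_nonneg ‖θ‖)
  have k3 := mul_le_mul_of_nonneg_right hm3 (sq_nonneg ‖p‖)
  linarith

theorem coreFunctional_le (hα : 0 < α) (hγ : 0 < γ) {μ : ℝ} (hμ : 0 ≤ μ) :
    ∃ M > 0, ∀ S : H →L[ℝ] H, (∀ x, ‖S x‖ ≤ s * ‖x‖) → ∀ p a ζ θ : H,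
      coreFunctional S α γ μ η p a ζ θ ≤ M * sqNorm p a ζ θ := by
  set c₁ := 1 / 2 + 2 * (μ / α) * ((η⁻¹) ^ 2 * s ^ 2)
  set c₂ := 1 / 2 * (γ / α) + 4 * (μ / α)
  set c₃ := 4 * (μ / α) * α ^ 2
  have h₁ : 0 ≤ c₁ := by positivity
  have h₂ : 0 ≤ c₂ := by positivity
  have h₃ : 0 ≤ c₃ := by positivity
  refine ⟨c₁ + c₂ + c₃ + 1, by positivity, fun S hSs p a ζ θ => ?_⟩
  unfold coreFunctional sqNorm
  have hb : ‖p - α • a‖ ^ 2 ≤ 2 * ‖p‖ ^ 2 + 2 * (α ^ 2 * ‖a‖ ^ 2) := by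
    have := norm_sub_sq_le p (α • a)
    rwa [norm_smul, mul_pow, Real.norm_eq_abs, sq_abs] at this
  have hf : ‖η⁻¹ • S θ‖ ^ 2 ≤ (η⁻¹) ^ 2 * s ^ 2 * ‖θ‖ ^ 2 := by
    rw [norm_smul, mul_pow, Real.norm_eq_abs, sq_abs, mul_assoc]
    exact mul_le_mul_of_nonneg_left (norm_apply_sq_le hSs θ) (by positivity)
  have hfb : ‖η⁻¹ • S θ + (p - α • a)‖ ^ 2 ≤ 2 * ((η⁻¹) ^ 2 * s ^ 2 * ‖θ‖ ^ 2)
      + 2 * (2 * ‖p‖ ^ 2 + 2 * (α ^ 2 * ‖a‖ ^ 2)) := by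
    have := norm_sub_sq_le (η⁻¹ • S θ) (-(p - α • a))
    rw [sub_neg_eq_add, norm_neg] at this
    linarith
  have hμα : 0 ≤ μ / α := by positivity
  have k1 := mul_le_mul_of_nonneg_left hfb hμα
  have k2 : 0 ≤ μ / α * ‖p - α • a‖ ^ 2 := by positivity
  have hc : c₁ * ‖θ‖ ^ 2 + c₂ * ‖p‖ ^ 2 + c₃ * ‖a‖ ^ 2 + 1 / 2 * ‖ζ‖ ^ 2
      ≤ (c₁ + c₂ + c₃ + 1) * (‖p‖ ^ 2 + ‖a‖ ^ 2 + ‖ζ‖ ^ 2 + ‖θ‖ ^ 2) := by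
    have := sq_nonneg ‖p‖
    have := sq_nonneg ‖a‖
    have := sq_nonneg ‖ζ‖
    have := sq_nonneg ‖θ‖
    have e : (c₁ + c₂ + c₃ + 1) * (‖p‖ ^ 2 + ‖a‖ ^ 2 + ‖ζ‖ ^ 2 + ‖θ‖ ^ 2)
        = (c₁ * ‖θ‖ ^ 2 + c₂ * ‖p‖ ^ 2 + c₃ * ‖a‖ ^ 2 + 1 * ‖ζ‖ ^ 2)
          + (c₁ * (‖p‖ ^ 2 + ‖a‖ ^ 2 + ‖ζ‖ ^ 2) + c₂ * (‖a‖ ^ 2 + ‖ζ‖ ^ 2 + ‖θ‖ ^ 2)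
            + c₃ * (‖p‖ ^ 2 + ‖ζ‖ ^ 2 + ‖θ‖ ^ 2) + 1 * (‖p‖ ^ 2 + ‖a‖ ^ 2 + ‖θ‖ ^ 2)) := by ring
    rw [e]
    have : 0 ≤ c₁ * (‖p‖ ^ 2 + ‖a‖ ^ 2 + ‖ζ‖ ^ 2) + c₂ * (‖a‖ ^ 2 + ‖ζ‖ ^ 2 + ‖θ‖ ^ 2)
            + c₃ * (‖p‖ ^ 2 + ‖ζ‖ ^ 2 + ‖θ‖ ^ 2) + 1 * (‖p‖ ^ 2 + ‖a‖ ^ 2 + ‖θ‖ ^ 2) := by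
      positivity
    linarith
  have e2 : c₁ * ‖θ‖ ^ 2 + c₂ * ‖p‖ ^ 2 + c₃ * ‖a‖ ^ 2 = 1 / 2 * ‖θ‖ ^ 2
      + 1 / 2 * (γ / α * ‖p‖ ^ 2) + μ / α * (2 * ((η⁻¹) ^ 2 * s ^ 2 * ‖θ‖ ^ 2)
      + 2 * (2 * ‖p‖ ^ 2 + 2 * (α ^ 2 * ‖a‖ ^ 2))) := by ring
  linarith

theorem abs_crossFunctional_sub_le (hs : 0 ≤ s) {S : H →L[ℝ] H}
    (hSs : ∀ x, ‖S x‖ ≤ s * ‖x‖) (p a ζ θ : H) :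
    |crossFunctional S γ η p a ζ θ - γ / 8 * ‖a‖ ^ 2|
      ≤ 2 * ‖ζ‖ ^ 2 + (4 / η) ^ 2 / 4 * s ^ 4 * ‖θ‖ ^ 2 + s ^ 2 / 4 * ‖p‖ ^ 2 := by
  have h1 := norm_apply_sq_le hSs p
  have h2 := mul_le_mul_of_nonneg_left (norm_apply_apply_sq_le hs hSs θ)
    (by positivity : 0 ≤ (4 / η) ^ 2 / 4)
  have i1 := mul_inner_le (4 / η) (by norm_num : (0 : ℝ) < 1) (S (S θ)) ζ
  have i2 := mul_inner_le (-(4 / η)) (by norm_num : (0 : ℝ) < 1) (S (S θ)) ζ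
  have i3 := mul_inner_le 1 (by norm_num : (0 : ℝ) < 1) (S p) ζ
  have i4 := mul_inner_le (-1) (by norm_num : (0 : ℝ) < 1) (S p) ζ
  rw [neg_sq] at i2
  unfold crossFunctional
  rw [abs_le]
  constructor <;> linarith

/-- The Lyapunov functional. -/
noncomputable def lyapunov (N : ℝ) (S : H →L[ℝ] H) (α γ μ η : ℝ) (p a ζ θ : H) : ℝ :=
  N * coreFunctional S α γ μ η p a ζ θ + crossFunctional S γ η p a ζ θ

/-- The constants are chosen before S, so they serve every symmetric S with ‖S‖ ≤ s. The conditions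
on g, h, q, r say that the state is regular at time t; only there is the functional differentiated.
-/
theorem exists_lyapunov (hα : 0 < α) (hη : η ≠ 0) (hκ : 0 < κ) (hγ : 0 < γ) (hs : 0 ≤ s)
    (hμ : 0 ≤ γ - α * β)
    (hcond : (γ - α * β) * (s ^ 4 + κ ^ 2 / α ^ 2) < κ * η ^ 2) :
    ∃ N m M c : ℝ, 0 < m ∧ 0 < M ∧ 0 < c ∧ ∀ S : H →L[ℝ] H,
      (∀ x y, ⟪S x, y⟫_ℝ = ⟪x, S y⟫_ℝ) → (∀ x, ‖S x‖ ≤ s * ‖x‖) →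
      (∀ p a ζ θ : H, m * sqNorm p a ζ θ ≤ lyapunov N S α γ (γ - α * β) η p a ζ θ ∧
        lyapunov N S α γ (γ - α * β) η p a ζ θ ≤ M * sqNorm p a ζ θ) ∧
      ∀ (p a ζ θ : ℝ → H) (g h q r : H) (t : ℝ) (I : Set ℝ), p t = S q → a t = S r →
        ζ t = S (S g) → θ t = S (S h) → HasDerivWithinAt p (S g) I t →
        HasDerivWithinAt a (p t - α • a t) I t →
        HasDerivWithinAt ζ (η • h - β • q - (γ - α * β) • r) I t →
        HasDerivWithinAt θ (-(κ • h) - η • g) I t →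
        ∃ D ≤ -(c * sqNorm (p t) (a t) (ζ t) (θ t)), HasDerivWithinAt
          (fun x => lyapunov N S α γ (γ - α * β) η (p x) (a x) (ζ x) (θ x)) D I t := by
  obtain ⟨m₀, hm₀, hcoer⟩ := coreFunctional_coercive (H := H) hα hη hκ hγ hμ hcond
  obtain ⟨M₀, hM₀, hup⟩ := coreFunctional_le (H := H) (s := s) (η := η) hα hγ hμ
  obtain ⟨c₁, hc₁, hdis⟩ := exists_core_dissipation_rate (H := H) hα hη hκ hs hμ hcond
  obtain ⟨C, hC, hcross⟩ := exists_cross_dissipation (H := H) (κ := κ) hα hη hγ hs hμ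
  set μ := γ - α * β with hμd
  set K := 3 + (4 / η) ^ 2 / 4 * s ^ 4 + s ^ 2 / 4 with hK
  have hK0 : 0 < K := by positivity
  -- N has two tasks: the core functional must dominate the indefinite part of the cross functional
  -- (K), and its dissipation must dominate the error C with 1 to spare.
  obtain ⟨N, hN0, hN1, hN2⟩ : ∃ N > 0, K ≤ N * m₀ ∧ C + 1 ≤ N * c₁ := by
    refine ⟨K / m₀ + (C + 1) / c₁, by positivity, ?_, ?_⟩
    · rw [add_mul, div_mul_cancel₀ _ hm₀.ne']
      have : 0 ≤ (C + 1) / c₁ * m₀ := by positivity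
      linarith
    · rw [add_mul, div_mul_cancel₀ _ hc₁.ne']
      have : 0 ≤ K / m₀ * c₁ := by positivity
      linarith
  obtain ⟨m, hm, hm1, hm2⟩ : ∃ m > 0, m ≤ 1 ∧ m ≤ γ / 8 :=
    ⟨min 1 (γ / 8), by positivity, min_le_left _ _, min_le_right _ _⟩
  -- The bound on c * s ^ 2 turns the spare ‖k‖² into dissipation of θ = S k.
  obtain ⟨c, hc, hcn1, hcn2, hcn3, hcn4⟩ : ∃ c > 0, c ≤ 1 ∧ c * s ^ 2 ≤ 1 ∧
      c ≤ 3 * γ / (8 * α) ∧ c ≤ α * γ / 8 := by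
    refine ⟨min (1 / (s ^ 2 + 1)) (min (3 * γ / (8 * α)) (α * γ / 8)), by positivity, ?_, ?_,
      (min_le_right _ _).trans (min_le_left _ _), (min_le_right _ _).trans (min_le_right _ _)⟩
    · refine (min_le_left _ _).trans ?_
      rw [div_le_one (by positivity)]
      linarith [sq_nonneg s]
    · refine (mul_le_mul_of_nonneg_right (min_le_left _ _) (sq_nonneg s)).trans ?_
      rw [div_mul_eq_mul_div, div_le_one (by positivity)]
      linarith
  refine ⟨N, m, N * M₀ + K + γ / 8, c, hm, by positivity, hc, fun S hS hSs => ⟨?_, ?_⟩⟩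
  · intro p a ζ θ
    have hcr := abs_le.1 (abs_crossFunctional_sub_le (γ := γ) (η := η) hs hSs p a ζ θ)
    have hP := sq_nonneg ‖p‖
    have hA := sq_nonneg ‖a‖
    have hZ := sq_nonneg ‖ζ‖
    have hΘ := sq_nonneg ‖θ‖
    have hKP : (s ^ 2 / 4 + 1) * ‖p‖ ^ 2 ≤ K * ‖p‖ ^ 2 := by
      refine mul_le_mul_of_nonneg_right ?_ hP
      have : 0 ≤ (4 / η) ^ 2 / 4 * s ^ 4 := by positivity
      linarith
    have hKZ : 3 * ‖ζ‖ ^ 2 ≤ K * ‖ζ‖ ^ 2 := by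
      refine mul_le_mul_of_nonneg_right ?_ hZ
      have : 0 ≤ (4 / η) ^ 2 / 4 * s ^ 4 := by positivity
      have : 0 ≤ s ^ 2 / 4 := by positivity
      linarith
    have hKΘ : ((4 / η) ^ 2 / 4 * s ^ 4 + 1) * ‖θ‖ ^ 2 ≤ K * ‖θ‖ ^ 2 := by
      refine mul_le_mul_of_nonneg_right ?_ hΘ
      have : 0 ≤ s ^ 2 / 4 := by positivity
      linarith
    unfold lyapunov
    constructor
    · have h1 := mul_le_mul_of_nonneg_left (hcoer S hSs p a ζ θ) hN0.le
      have h2 := mul_le_mul_of_nonneg_right hN1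
        (by positivity : 0 ≤ ‖p‖ ^ 2 + ‖ζ‖ ^ 2 + ‖θ‖ ^ 2)
      have k1 := mul_le_mul_of_nonneg_right hm1
        (by positivity : 0 ≤ ‖p‖ ^ 2 + ‖ζ‖ ^ 2 + ‖θ‖ ^ 2)
      have k2 := mul_le_mul_of_nonneg_right hm2 hA
      unfold sqNorm
      linarith
    · have h1 := mul_le_mul_of_nonneg_left (hup S hSs p a ζ θ) hN0.le
      have h2 : 0 ≤ K * ‖a‖ ^ 2 := by positivity
      have h3 : 0 ≤ γ / 8 * (‖p‖ ^ 2 + ‖ζ‖ ^ 2 + ‖θ‖ ^ 2) := by positivity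
      unfold sqNorm at h1 ⊢
      linarith
  · intro p a ζ θ g h q r t I hpt hat hζt hθt hp ha hζ hθ
    refine ⟨_, ?_, ((hasDerivWithinAt_coreFunctional hp ha hζ hθ).const_mul N).add
      (hasDerivWithinAt_crossFunctional hp ha hζ hθ)⟩
    rw [hpt, hat, hζt, hθt]
    have h1 := coreFunctional_dissipation (β := β) (γ := γ) (κ := κ) hα hη hS g h q r
    have h2 := hcross S hS hSs g h q r
    have h3 := hdis S hSs (S h) (S q - α • S r)
    simp only at h1 h2
    rw [← hμd] at h1
    rw [h1]
    have h4 := mul_le_mul_of_nonneg_left h3 hN0.le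
    have h5 := mul_le_mul_of_nonneg_right hN2
      (by positivity : 0 ≤ ‖S h‖ ^ 2 + μ * ‖S q - α • S r‖ ^ 2)
    have h6 : 0 ≤ μ * ‖S q - α • S r‖ ^ 2 := by positivity
    have k1 := mul_le_mul_of_nonneg_right hcn1 (sq_nonneg ‖S (S g)‖)
    have k2 := mul_le_mul_of_nonneg_right hcn2 (sq_nonneg ‖S h‖)
    have k3 := mul_le_mul_of_nonneg_right hcn3 (sq_nonneg ‖S q‖)
    have k4 := mul_le_mul_of_nonneg_right hcn4 (sq_nonneg ‖S r‖)
    have k5 := mul_le_mul_of_nonneg_left (norm_apply_sq_le hSs (S h)) hc.le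
    unfold sqNorm
    linarith

/-- A function whose derivative is at most `-ω` times itself decays exponentially. -/
theorem le_mul_exp_of_deriv_le {f f' : ℝ → ℝ} {ω : ℝ}
    (hf : ∀ t, 0 ≤ t → HasDerivWithinAt f (f' t) (Ici 0) t)
    (hf' : ∀ t, 0 ≤ t → f' t ≤ -(ω * f t)) {t : ℝ} (ht : 0 ≤ t) :
    f t ≤ f 0 * Real.exp (-ω * t) := by
  have hd : ∀ t, 0 ≤ t → HasDerivWithinAt (fun x => f x * Real.exp (ω * x))
      (f' t * Real.exp (ω * t) + f t * (Real.exp (ω * t) * ω)) (Ici 0) t := fun t ht =>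
    (hf t ht).mul (by simpa using (((hasDerivAt_id t).const_mul ω).exp).hasDerivWithinAt)
  have hanti : AntitoneOn (fun x => f x * Real.exp (ω * x)) (Ici 0) := by
    have hA : ∀ x ∈ interior (Ici (0 : ℝ)), HasDerivAt (fun x => f x * Real.exp (ω * x))
        (f' x * Real.exp (ω * x) + f x * (Real.exp (ω * x) * ω)) x := by
      intro x hx
      rw [interior_Ici] at hx
      exact (hd x (le_of_lt hx)).hasDerivAt (Ici_mem_nhds hx)
    refine antitoneOn_of_deriv_nonpos (convex_Ici 0)
      (fun x hx => (hd x hx).continuousWithinAt)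
      (fun x hx => (hA x hx).differentiableAt.differentiableWithinAt) fun x hx => ?_
    rw [(hA x hx).deriv]
    rw [interior_Ici] at hx
    have h1 := mul_le_mul_of_nonneg_right (hf' x (le_of_lt hx)) (Real.exp_pos (ω * x)).le
    linarith
  have h1 := hanti (self_mem_Ici) ht ht
  simp only [mul_zero, Real.exp_zero, mul_one] at h1
  rw [neg_mul, Real.exp_neg, ← div_eq_mul_inv, le_div_iff₀ (Real.exp_pos _)]
  exact h1

/-- The a priori estimate for regular solutions. M and ω are independent of S, which allows both a
passage to the limit in S and the use on regularized differences. -/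
theorem exists_uniform_decay (hα : 0 < α) (hη : η ≠ 0) (hκ : 0 < κ) (hγ : 0 < γ) (hs : 0 ≤ s)
    (hμ : 0 ≤ γ - α * β)
    (hcond : (γ - α * β) * (s ^ 4 + κ ^ 2 / α ^ 2) < κ * η ^ 2) :
    ∃ M ω : ℝ, 0 < M ∧ 0 < ω ∧ ∀ S : H →L[ℝ] H,
      (∀ x y, ⟪S x, y⟫_ℝ = ⟪x, S y⟫_ℝ) → (∀ x, ‖S x‖ ≤ s * ‖x‖) →
      ∀ p a ζ θ g h q r : ℝ → H, (∀ t, 0 ≤ t → p t = S (q t)) → (∀ t, 0 ≤ t → a t = S (r t)) →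
        (∀ t, 0 ≤ t → ζ t = S (S (g t))) → (∀ t, 0 ≤ t → θ t = S (S (h t))) →
        (∀ t, 0 ≤ t → HasDerivWithinAt p (S (g t)) (Ici 0) t) →
        (∀ t, 0 ≤ t → HasDerivWithinAt a (p t - α • a t) (Ici 0) t) →
        (∀ t, 0 ≤ t → HasDerivWithinAt ζ
          (η • h t - β • q t - (γ - α * β) • r t) (Ici 0) t) →
        (∀ t, 0 ≤ t → HasDerivWithinAt θ (-(κ • h t) - η • g t) (Ici 0) t) →
        ∀ t, 0 ≤ t → sqNorm (p t) (a t) (ζ t) (θ t)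
          ≤ M * sqNorm (p 0) (a 0) (ζ 0) (θ 0) * Real.exp (-ω * t) := by
  obtain ⟨N, m, M, c, hm, hM, hc, hL⟩ :=
    exists_lyapunov (H := H) hα hη hκ hγ hs hμ hcond
  refine ⟨M / m, c / M, by positivity, by positivity, ?_⟩
  intro S hS hSs p a ζ θ g h q r hpq har hζg hθh hp ha hζ hθ t ht
  obtain ⟨hbd, hder⟩ := hL S hS hSs
  have hex : ∀ t : ℝ, ∃ D, 0 ≤ t → D ≤ -(c * sqNorm (p t) (a t) (ζ t) (θ t)) ∧ HasDerivWithinAt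
      (fun x => lyapunov N S α γ (γ - α * β) η (p x) (a x) (ζ x) (θ x)) D (Ici 0) t := by
    intro t
    by_cases ht : 0 ≤ t
    · obtain ⟨D, h1, h2⟩ := hder p a ζ θ (g t) (h t) (q t) (r t) t (Ici 0) (hpq t ht) (har t ht)
        (hζg t ht) (hθh t ht) (hp t ht) (ha t ht) (hζ t ht) (hθ t ht)
      exact ⟨D, fun _ => ⟨h1, h2⟩⟩
    · exact ⟨0, fun h => absurd h ht⟩
  choose D hD using hex
  have h1 := le_mul_exp_of_deriv_le (ω := c / M) (fun t ht => (hD t ht).2) (fun t ht => by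
    refine (hD t ht).1.trans (neg_le_neg ?_)
    rw [div_mul_eq_mul_div, div_le_iff₀ hM, mul_assoc, mul_comm _ M]
    exact mul_le_mul_of_nonneg_left (hbd _ _ _ _).2 hc.le) ht
  have h2 := (hbd (p t) (a t) (ζ t) (θ t)).1
  have h3 := mul_le_mul_of_nonneg_right (hbd (p 0) (a 0) (ζ 0) (θ 0)).2
    (Real.exp_pos (-(c / M) * t)).le
  have h4 : M / m * sqNorm (p 0) (a 0) (ζ 0) (θ 0) * Real.exp (-(c / M) * t)
      = M * sqNorm (p 0) (a 0) (ζ 0) (θ 0) * Real.exp (-(c / M) * t) / m := by ring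
  rw [h4, le_div_iff₀ hm, mul_comm _ m]
  exact h2.trans (h1.trans h3)

end Lyapunov

/-! ### Calculus on the half-line -/

section Calculus

variable {E F : Type*} [NormedAddCommGroup E] [NormedSpace ℝ E] [CompleteSpace E]
  [NormedAddCommGroup F] [NormedSpace ℝ F]

theorem hasDerivWithinAt_integral_Ici {f : ℝ → E} (hf : ContinuousOn f (Ici 0)) {t : ℝ}
    (ht : 0 ≤ t) : HasDerivWithinAt (fun x => ∫ y in (0 : ℝ)..x, f y) (f t) (Ici 0) t := by
  -- Extending f by f(0) to negative times gives a function continuous on the whole line, to which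
  -- the two-sided fundamental theorem applies.
  have hc : Continuous fun x => f (max x 0) :=
    hf.comp_continuous (continuous_id.max continuous_const) fun x => le_max_right x 0
  have h1 := (hc.integral_hasStrictDerivAt 0 t).hasDerivAt.hasDerivWithinAt (s := Ici (0 : ℝ))
  rw [max_eq_left ht] at h1
  have h2 : ∀ x ∈ Ici (0 : ℝ), (∫ y in (0 : ℝ)..x, f y) = ∫ y in (0 : ℝ)..x, f (max y 0) := by
    intro x hx
    refine intervalIntegral.integral_congr fun y hy => ?_
    rw [uIcc_of_le hx] at hy
    simp only [max_eq_left hy.1]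
  exact h1.congr h2 (h2 t ht)

theorem eq_of_hasDerivWithinAt_eq {f g : ℝ → F} {f' : ℝ → F}
    (hf : ∀ t, 0 ≤ t → HasDerivWithinAt f (f' t) (Ici 0) t)
    (hg : ∀ t, 0 ≤ t → HasDerivWithinAt g (f' t) (Ici 0) t) (h0 : f 0 = g 0) {t : ℝ}
    (ht : 0 ≤ t) : f t = g t := by
  have h1 : ∀ x, 0 ≤ x → HasDerivWithinAt (fun x => f x - g x) 0 (Ici 0) x := fun x hx => by
    have h := (hf x hx).sub (hg x hx)
    rwa [sub_self] at h
  have h2 := constant_of_has_deriv_right_zero (f := fun x => f x - g x) (a := 0) (b := t)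
    (fun x hx => ((h1 x hx.1).continuousWithinAt).mono Icc_subset_Ici_self)
    (fun x hx => (h1 x hx.1).mono (Ici_subset_Ici.2 hx.1)) t ⟨ht, le_rfl⟩
  simp only [h0, sub_self] at h2
  exact sub_eq_zero.1 h2

/-- A function is differentiable as soon as its images under a separating family of bounded
operators are, with compatible continuous derivatives. -/
theorem hasDerivWithinAt_of_separating {ι : Type*} (C : ι → E →L[ℝ] F)
    (hC : ∀ x, (∀ i, C i x = 0) → x = 0) {f f' : ℝ → E} (hf' : ContinuousOn f' (Ici 0))
    (hd : ∀ i t, 0 ≤ t → HasDerivWithinAt (fun x => C i (f x)) (C i (f' t)) (Ici 0) t) {t : ℝ}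
    (ht : 0 ≤ t) : HasDerivWithinAt f (f' t) (Ici 0) t := by
  -- Both sides have the same images under every C i, so f is the primitive of a continuous
  -- function.
  have key : ∀ x ∈ Ici (0 : ℝ), f x = f 0 + ∫ y in (0 : ℝ)..x, f' y := by
    intro x hx
    refine sub_eq_zero.1 (hC _ fun i => ?_)
    rw [map_sub, sub_eq_zero]
    refine eq_of_hasDerivWithinAt_eq (f := fun x => C i (f x))
      (g := fun x => C i (f 0 + ∫ y in (0 : ℝ)..x, f' y)) (hd i) (fun s hs => ?_) (by simp) hx
    exact (C i).hasFDerivAt.comp_hasDerivWithinAt s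
      ((hasDerivWithinAt_integral_Ici hf' hs).const_add _)
  exact ((hasDerivWithinAt_integral_Ici hf' ht).const_add _).congr key (key t ht)

end Calculus

/-! ### Limits of uniformly continuous groups -/

section Semigroup

open NormedSpace (exp)

variable {X : Type*} [NormedAddCommGroup X] [NormedSpace ℝ X] [CompleteSpace X]

theorem hasDerivAt_exp_smul_apply (G : X →L[ℝ] X) (x : X) (t : ℝ) :
    HasDerivAt (fun u : ℝ => exp (u • G) x) (G (exp (t • G) x)) t := by
  have h := (hasDerivAt_exp_smul_const' (𝕂 := ℝ) G t).clm_apply (hasDerivAt_const t x)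
  simpa using h

/-- Duhamel's formula: the derivative in s of exp((t-s)G) exp(sG') J z contains G' - G. As J
commutes with exp(sG'), it can be moved next to this difference, so only ‖G'J - GJ‖ enters, not ‖G'
- G‖. -/
theorem norm_exp_sub_exp_le {G G' J : X →L[ℝ] X} {K : ℝ} (hK0 : 0 ≤ K)
    (hG : ∀ t : ℝ, 0 ≤ t → ∀ x, ‖exp (t • G) x‖ ≤ K * ‖x‖)
    (hG' : ∀ t : ℝ, 0 ≤ t → ∀ x, ‖exp (t • G') x‖ ≤ K * ‖x‖)
    (hJ' : Commute J G') (z : X) {t : ℝ} (ht : 0 ≤ t) :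
    ‖exp (t • G') (J z) - exp (t • G) (J z)‖ ≤ K * (‖G' * J - G * J‖ * (K * ‖z‖)) * t := by
  have hder : ∀ s, HasDerivAt (fun s : ℝ => exp ((t - s) • G) (exp (s • G') (J z)))
      (exp ((t - s) • G) ((G' * J - G * J) (exp (s • G') z))) s := by
    intro s
    have h0 := (hasDerivAt_exp_smul_const (𝕂 := ℝ) G (t - s)).scomp s
      ((hasDerivAt_id s).const_sub t)
    have h1 := h0.clm_apply (hasDerivAt_exp_smul_apply G' (J z) s)
    refine h1.congr_deriv ?_
    have hc : exp (s • G') (J z) = J (exp (s • G') z) := by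
      have : Commute J (exp (s • G')) := (hJ'.smul_right s).exp_right
      exact (congrArg (fun B : X →L[ℝ] X => B z) this.eq).symm
    simp only [Function.comp_apply, hc, neg_smul, one_smul, neg_apply,
      mul_apply_eq_comp, sub_apply, map_sub]
    abel
  have hmv := (convex_Icc (0 : ℝ) t).norm_image_sub_le_of_norm_hasDerivWithin_le
    (fun s _ => (hder s).hasDerivWithinAt) (C := K * (‖G' * J - G * J‖ * (K * ‖z‖)))
    (fun s hs => (hG (t - s) (sub_nonneg.2 hs.2) _).trans (mul_le_mul_of_nonneg_left
      (((G' * J - G * J).le_opNorm _).trans (mul_le_mul_of_nonneg_left (hG' s hs.1 z)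
        (norm_nonneg _))) hK0)) (left_mem_Icc.2 ht) (right_mem_Icc.2 ht)
  simpa [abs_of_nonneg ht, NormedSpace.exp_zero] using hmv

/-- Approximate x by some J z: uniform boundedness controls both groups on x - J z by e/4 each, and
Duhamel's estimate controls the difference on J z by e/2. -/
theorem uniformCauchySeqOn_exp {G : ℕ → X →L[ℝ] X} {J B : X →L[ℝ] X} {K : ℝ} (hK0 : 0 < K)
    (hG : ∀ n, ∀ t : ℝ, 0 ≤ t → ∀ x, ‖exp (t • G n) x‖ ≤ K * ‖x‖)
    (hJ : ∀ n, Commute J (G n)) (hJd : DenseRange J)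
    (hB : Tendsto (fun n => G n * J) atTop (𝓝 B)) (x : X) {τ : ℝ} (hτ : 0 ≤ τ) :
    UniformCauchySeqOn (fun n t => exp (t • G n) x) atTop (Icc 0 τ) := by
  rw [Metric.uniformCauchySeqOn_iff]
  intro e he
  obtain ⟨z, hz⟩ := hJd.exists_dist_lt x (by positivity : 0 < e / (4 * K))
  have hc : 0 < K * (K * (‖z‖ + 1)) * (τ + 1) := by positivity
  obtain ⟨N, hN⟩ := Metric.cauchySeq_iff.1 hB.cauchySeq (e / (2 * (K * (K * (‖z‖ + 1)) * (τ + 1))))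
    (by positivity)
  refine ⟨N, fun m hm n hn t ht => ?_⟩
  have h1 := norm_exp_sub_exp_le hK0.le (hG n) (hG m) (hJ m) z ht.1
  have h2 := hN m hm n hn
  rw [dist_eq_norm, lt_div_iff₀ (by positivity)] at h2
  have h3 : ∀ k, ‖exp (t • G k) (x - J z)‖ ≤ e / 4 := by
    intro k
    refine (hG k t ht.1 _).trans ?_
    rw [dist_eq_norm] at hz
    have := mul_le_mul_of_nonneg_left hz.le hK0.le
    refine this.trans (le_of_eq ?_)
    field_simp
  have h4 : K * (‖G m * J - G n * J‖ * (K * ‖z‖)) * t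
      ≤ ‖G m * J - G n * J‖ * (K * (K * (‖z‖ + 1)) * (τ + 1)) := by
    have : K * (‖G m * J - G n * J‖ * (K * ‖z‖)) * t
        = ‖G m * J - G n * J‖ * (K * (K * ‖z‖) * t) := by ring
    rw [this]
    have h5 := ht.2
    have h6 := ht.1
    gcongr <;> linarith
  have h5 : exp (t • G m) x - exp (t • G n) x = exp (t • G m) (x - J z)
      - exp (t • G n) (x - J z) + (exp (t • G m) (J z) - exp (t • G n) (J z)) := by
    simp only [map_sub]; abel
  rw [dist_eq_norm, h5]
  refine ((norm_add_le _ _).trans (add_le_add_left (norm_sub_le _ _) _)).trans_lt ?_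
  have := h3 m
  have := h3 n
  linarith

/-- Uniformly bounded groups whose generators converge on a core converge strongly, and the limit
solves the limit equation after regularization. -/
theorem exists_limit_semigroup {G : ℕ → X →L[ℝ] X} {J B : X →L[ℝ] X} {K : ℝ} (hK0 : 0 < K)
    (hG : ∀ n, ∀ t : ℝ, 0 ≤ t → ∀ x, ‖exp (t • G n) x‖ ≤ K * ‖x‖)
    (hJ : ∀ n, Commute J (G n)) (hJd : DenseRange J)
    (hB : Tendsto (fun n => G n * J) atTop (𝓝 B)) :
    ∃ V : ℝ → X → X, (∀ x t, 0 ≤ t → Tendsto (fun n => exp (t • G n) x) atTop (𝓝 (V t x))) ∧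
      (∀ x, ContinuousOn (fun t => V t x) (Ici 0)) ∧
      ∀ x t, 0 ≤ t → HasDerivWithinAt (fun t => J (V t x)) (B (V t x)) (Ici 0) t := by
  have hlim : ∀ (t : ℝ) x, ∃ y, 0 ≤ t → Tendsto (fun n => exp (t • G n) x) atTop (𝓝 y) := by
    intro t x
    by_cases ht : 0 ≤ t
    · obtain ⟨y, hy⟩ := cauchySeq_tendsto_of_complete
        ((uniformCauchySeqOn_exp hK0 hG hJ hJd hB x ht).cauchySeq (right_mem_Icc.2 ht))
      exact ⟨y, fun _ => hy⟩
    · exact ⟨0, fun h => absurd h ht⟩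
  choose V hV using hlim
  have hcont : ∀ x, ContinuousOn (fun t => V t x) (Ici 0) := by
    intro x t ht
    have h1 := (uniformCauchySeqOn_exp hK0 hG hJ hJd hB x
      (by linarith [mem_Ici.1 ht] : 0 ≤ t + 1)).tendstoUniformlyOn_of_tendsto
      (f := fun t => V t x) (fun s hs => hV s x hs.1)
    have h2 : ContinuousOn (fun t => V t x) (Icc 0 (t + 1)) :=
      h1.continuousOn (Frequently.of_forall fun n s _ =>
        (hasDerivAt_exp_smul_apply (G n) x s).continuousAt.continuousWithinAt)
    refine (h2 t ⟨ht, by linarith⟩).mono_of_mem_nhdsWithin ?_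
    rw [← Ici_inter_Iic]
    exact inter_mem_nhdsWithin _ (Iic_mem_nhds (by linarith))
  refine ⟨V, fun x t ht => hV t x ht, hcont, fun x t ht => ?_⟩
  have hBV : ContinuousOn (fun t => B (V t x)) (Ici 0) := B.continuous.comp_continuousOn (hcont x)
  -- The integrated equation for exp(t G n) involves only G n * J, which converges in norm;
  -- dominated convergence gives the limit equation.
  have key : ∀ t ∈ Ici (0 : ℝ), J (V t x) = J x + ∫ s in (0 : ℝ)..t, B (V s x) := by
    intro t ht
    have hn : ∀ n, J (exp (t • G n) x) = J x + ∫ s in (0 : ℝ)..t, (G n * J) (exp (s • G n) x) := by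
      intro n
      have hd : ∀ s, HasDerivAt (fun s : ℝ => J (exp (s • G n) x))
          ((G n * J) (exp (s • G n) x)) s := by
        intro s
        have h1 := J.hasFDerivAt.comp_hasDerivAt s (hasDerivAt_exp_smul_apply (G n) x s)
        rw [← (hJ n).eq]
        exact h1
      have hc : Continuous fun s : ℝ => (G n * J) (exp (s • G n) x) :=
        (G n * J).continuous.comp (continuous_iff_continuousAt.2 fun s =>
          (hasDerivAt_exp_smul_apply (G n) x s).continuousAt)
      rw [intervalIntegral.integral_eq_sub_of_hasDerivAt (fun s _ => hd s)
        (hc.intervalIntegrable 0 t)]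
      simp [NormedSpace.exp_zero]
    have hl : Tendsto (fun n => J (exp (t • G n) x)) atTop (𝓝 (J (V t x))) :=
      (J.continuous.tendsto _).comp (hV t x ht)
    obtain ⟨b, hb⟩ := hB.norm.bddAbove_range
    have hr : Tendsto (fun n => ∫ s in (0 : ℝ)..t, (G n * J) (exp (s • G n) x)) atTop
        (𝓝 (∫ s in (0 : ℝ)..t, B (V s x))) := by
      refine intervalIntegral.tendsto_integral_filter_of_dominated_convergence
        (fun _ => b * (K * ‖x‖)) (Eventually.of_forall fun n => ?_)
        (Eventually.of_forall fun n => ?_) intervalIntegrable_const ?_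
      · exact ((G n * J).continuous.comp (continuous_iff_continuousAt.2 fun s =>
          (hasDerivAt_exp_smul_apply (G n) x s).continuousAt)).aestronglyMeasurable
      · refine Eventually.of_forall fun s hs => ?_
        rw [uIoc_of_le ht] at hs
        exact ((G n * J).le_opNorm _).trans (mul_le_mul (hb ⟨n, rfl⟩) (hG n s hs.1.le x)
          (norm_nonneg _) ((norm_nonneg _).trans (hb ⟨n, rfl⟩)))
      · refine Eventually.of_forall fun s hs => ?_
        rw [uIoc_of_le ht] at hs
        have hE : Continuous fun q : (X →L[ℝ] X) × X => q.1 q.2 := by fun_prop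
        exact (hE.tendsto (B, V s x)).comp (hB.prodMk_nhds (hV s x hs.1.le))
    exact tendsto_nhds_unique hl ((tendsto_const_nhds.add hr).congr fun n => (hn n).symm)
  exact ((hasDerivWithinAt_integral_Ici hBV ht).const_add _).congr key (key t ht)

end Semigroup

/-! ### The system in the coordinates `(p, a, ζ, θ)` -/

open ContinuousLinearMap in
/-- For `c₀ = 1`, `c₁ = A^{1/2}`, `c₂ = A` this is the generator of the system in the coordinates
`p = A^{1/2}(v + α u)`, `a = A^{1/2} u`, `ζ = w + α v`, `θ`. -/
noncomputable def generator (α β μ κ η : ℝ) (c₀ c₁ c₂ : H →L[ℝ] H) :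
    (H × H × H × H) →L[ℝ] (H × H × H × H) :=
  let πp : (H × H × H × H) →L[ℝ] H := fst ℝ H (H × H × H)
  let πa : (H × H × H × H) →L[ℝ] H := fst ℝ H (H × H) ∘L snd ℝ H (H × H × H)
  let πζ : (H × H × H × H) →L[ℝ] H := fst ℝ H H ∘L snd ℝ H (H × H) ∘L snd ℝ H (H × H × H)
  let πθ : (H × H × H × H) →L[ℝ] H := snd ℝ H H ∘L snd ℝ H (H × H) ∘L snd ℝ H (H × H × H)
  inl ℝ H (H × H × H) ∘L c₁ ∘L πζ
    + inr ℝ H (H × H × H) ∘L (inl ℝ H (H × H) ∘L c₀ ∘L (πp - α • πa)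
    + inr ℝ H (H × H) ∘L (inl ℝ H H ∘L (η • (c₂ ∘L πθ) - c₁ ∘L (β • πp + μ • πa))
    + inr ℝ H H ∘L (-(c₂ ∘L (κ • πθ + η • πζ)))))

/-- The operator `S` acting on each component. -/
def diag (S : H →L[ℝ] H) : (H × H × H × H) →L[ℝ] (H × H × H × H) :=
  S.prodMap (S.prodMap (S.prodMap S))

section Generator

variable {α β μ κ η : ℝ}

theorem diag_apply (S : H →L[ℝ] H) (y : H × H × H × H) :
    diag S y = (S y.1, S y.2.1, S y.2.2.1, S y.2.2.2) := rfl

theorem generator_apply (c₀ c₁ c₂ : H →L[ℝ] H) (y : H × H × H × H) :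
    generator α β μ κ η c₀ c₁ c₂ y = (c₁ y.2.2.1, c₀ (y.1 - α • y.2.1),
      η • c₂ y.2.2.2 - c₁ (β • y.1 + μ • y.2.1), -c₂ (κ • y.2.2.2 + η • y.2.2.1)) := by
  simp [generator]

theorem continuous_generator : Continuous fun c : (H →L[ℝ] H) × (H →L[ℝ] H) × (H →L[ℝ] H) =>
    generator α β μ κ η c.1 c.2.1 c.2.2 := by
  unfold generator
  fun_prop

/-- Multiplying by S componentwise only changes the three coefficients. Thus `generator` with
coefficients S * S, S, 1 is A⁻¹ times the unbounded generator, and the system can be stated with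
bounded operators. -/
theorem diag_mul_generator (S c₀ c₁ c₂ : H →L[ℝ] H) :
    diag S * generator α β μ κ η c₀ c₁ c₂
      = generator α β μ κ η (S * c₀) (S * c₁) (S * c₂) := by
  refine ContinuousLinearMap.ext fun y => ?_
  simp only [mul_apply_eq_comp, generator_apply, diag_apply, map_sub, map_neg, map_smul]

theorem generator_mul_diag (S c₀ c₁ c₂ : H →L[ℝ] H) :
    generator α β μ κ η c₀ c₁ c₂ * diag S
      = generator α β μ κ η (c₀ * S) (c₁ * S) (c₂ * S) := by
  refine ContinuousLinearMap.ext fun y => ?_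
  simp only [mul_apply_eq_comp, generator_apply, diag_apply, map_sub, map_add, map_smul]

end Generator

/-! ### Approximation of the unbounded square root -/

theorem exists_shift_inverse [CompleteSpace H] {S : H →L[ℝ] H} (hpos : ∀ x, 0 ≤ ⟪S x, x⟫_ℝ)
    {ε : ℝ} (hε : 0 < ε) :
    ∃ R : H →L[ℝ] H, R * (S + ε • 1) = 1 ∧ (S + ε • 1) * R = 1 := by
  have hu : IsUnit (S + ε • (1 : H →L[ℝ] H)) := by
    refine ContinuousLinearMap.isUnit_of_forall_le_norm_inner_map _ (c := ⟨ε, hε.le⟩) hε fun x => ?_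
    have h1 : ⟪(S + ε • (1 : H →L[ℝ] H)) x, x⟫_ℝ = ⟪S x, x⟫_ℝ + ε * ‖x‖ ^ 2 := by
      simp [inner_add_left, real_inner_smul_left]
    rw [h1, Real.norm_eq_abs]
    refine le_trans ?_ (le_abs_self _)
    have := hpos x
    change ‖x‖ ^ 2 * ε ≤ _
    linarith
  obtain ⟨u, hu⟩ := hu
  exact ⟨(↑u⁻¹ : H →L[ℝ] H), by rw [← hu]; simp, by rw [← hu]; simp⟩

/-- Expand the square of x = S R x + ε R x: the cross term is nonnegative because S is. -/
theorem norm_mul_shift_inverse_le {S R : H →L[ℝ] H} (hpos : ∀ x, 0 ≤ ⟪S x, x⟫_ℝ) {ε : ℝ}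
    (hε : 0 < ε) (hR : (S + ε • 1) * R = 1) : ‖S * R‖ ≤ 1 := by
  refine ContinuousLinearMap.opNorm_le_bound _ zero_le_one fun x => ?_
  have h1 : S (R x) + ε • R x = x := congrArg (fun B : H →L[ℝ] H => B x) hR
  rw [one_mul, mul_apply_eq_comp]
  refine le_of_sq_le_sq ?_ (norm_nonneg x)
  conv_rhs => rw [← h1]
  rw [norm_add_sq_real, inner_smul_right]
  have := mul_nonneg hε.le (hpos (R x))
  have := sq_nonneg ‖ε • R x‖
  linarith

/-- From R S S - S = -ε R S and ‖R S‖ ≤ 1 one gets R S S → S in norm. The third power of S is what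
makes R R S S S converge in norm; R R S S = (R S)² in general converges only strongly. -/
theorem tendsto_shift_inverse {S : H →L[ℝ] H} (hpos : ∀ x, 0 ≤ ⟪S x, x⟫_ℝ) {ε : ℕ → ℝ}
    (hε : ∀ n, 0 < ε n) (hε0 : Tendsto ε atTop (𝓝 0)) {R : ℕ → H →L[ℝ] H}
    (hR : ∀ n, R n * (S + ε n • 1) = 1) (hR' : ∀ n, (S + ε n • 1) * R n = 1) :
    Tendsto (fun n => R n * (S * S * S)) atTop (𝓝 (S * S)) ∧
      Tendsto (fun n => R n * R n * (S * S * S)) atTop (𝓝 S) := by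
  have hRS : ∀ n, R n * S = 1 - ε n • R n := fun n => by
    rw [eq_sub_iff_add_eq, ← hR n, mul_add, mul_smul_comm, mul_one]
  have hSR : ∀ n, S * R n = 1 - ε n • R n := fun n => by
    rw [eq_sub_iff_add_eq, ← hR' n, add_mul, smul_mul_assoc, one_mul]
  have hcomm : ∀ n, R n * S = S * R n := fun n => by rw [hRS, hSR]
  have hbd : ∀ n, ‖R n * S‖ ≤ 1 := fun n => by
    rw [hcomm]; exact norm_mul_shift_inverse_le hpos (hε n) (hR' n)
  have hz : Tendsto (fun n => R n * S * S - S) atTop (𝓝 0) := by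
    have h1 : ∀ n, R n * S * S - S = -(ε n • (R n * S)) := fun n => by
      conv_lhs => rw [hRS]
      rw [sub_mul, one_mul, smul_mul_assoc]; abel
    refine squeeze_zero_norm (fun n => ?_) hε0
    rw [h1, norm_neg, norm_smul, Real.norm_of_nonneg (hε n).le]
    exact mul_le_of_le_one_right (hε n).le (hbd n)
  have h1 : Tendsto (fun n => R n * S * S) atTop (𝓝 S) := by
    simpa using hz.add_const S
  refine ⟨(h1.mul_const S).congr fun n => by noncomm_ring, ?_⟩
  have h2 : Tendsto (fun n => R n * S * (R n * S * S - S)) atTop (𝓝 0) := by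
    refine squeeze_zero_norm (fun n => ?_) (tendsto_zero_iff_norm_tendsto_zero.1 hz)
    exact (norm_mul_le _ _).trans (mul_le_of_le_one_left (norm_nonneg _) (hbd n))
  have h3 := h2.add h1
  rw [zero_add] at h3
  refine h3.congr fun n => ?_
  have : R n * R n * (S * S * S) = R n * S * (R n * S * S) := by
    have := hcomm n
    calc R n * R n * (S * S * S) = R n * (R n * S) * (S * S) := by noncomm_ring
      _ = R n * (S * R n) * (S * S) := by rw [this]
      _ = _ := by noncomm_ring
  rw [this]
  noncomm_ring

theorem denseRange_of_symmetric_injective [CompleteSpace H] {S : H →L[ℝ] H}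
    (hS : ∀ x y, ⟪S x, y⟫_ℝ = ⟪x, S y⟫_ℝ) (hinj : ∀ x, S x = 0 → x = 0) : DenseRange S := by
  have h : (LinearMap.range (S : H →ₗ[ℝ] H)).topologicalClosure = ⊤ := by
    rw [Submodule.topologicalClosure_eq_top_iff, Submodule.eq_bot_iff]
    intro z hz
    rw [Submodule.mem_orthogonal] at hz
    refine hinj z (inner_self_eq_zero (𝕜 := ℝ).1 ?_)
    rw [← hS]
    exact hz _ ⟨_, rfl⟩
  exact Submodule.dense_iff_topologicalClosure_eq_top.2 h

theorem norm_sq_le_sqNorm {E : Type*} [NormedAddCommGroup E] (y : E × E × E × E) :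
    ‖y‖ ^ 2 ≤ sqNorm y.1 y.2.1 y.2.2.1 y.2.2.2 := by
  obtain ⟨p, a, ζ, θ⟩ := y
  have h : ‖(p, a, ζ, θ)‖ ≤ √(sqNorm p a ζ θ) := by
    simp only [Prod.norm_mk, max_le_iff]
    refine ⟨?_, ?_, ?_, ?_⟩ <;> refine Real.le_sqrt_of_sq_le ?_ <;> unfold sqNorm <;>
      linarith [sq_nonneg ‖p‖, sq_nonneg ‖a‖, sq_nonneg ‖ζ‖, sq_nonneg ‖θ‖]
  have := pow_le_pow_left₀ (norm_nonneg _) h 2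
  rwa [Real.sq_sqrt (sqNorm_nonneg _ _ _ _)] at this

theorem sqNorm_le_norm_sq {E : Type*} [NormedAddCommGroup E] (y : E × E × E × E) :
    sqNorm y.1 y.2.1 y.2.2.1 y.2.2.2 ≤ 4 * ‖y‖ ^ 2 := by
  have h1 := pow_le_pow_left₀ (norm_nonneg _) (norm_fst_le y) 2
  have h2 := pow_le_pow_left₀ (norm_nonneg _) ((norm_fst_le y.2).trans (norm_snd_le y)) 2
  have h3 := pow_le_pow_left₀ (norm_nonneg _)
    ((norm_fst_le y.2.2).trans ((norm_snd_le y.2).trans (norm_snd_le y))) 2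
  have h4 := pow_le_pow_left₀ (norm_nonneg _)
    ((norm_snd_le y.2.2).trans ((norm_snd_le y.2).trans (norm_snd_le y))) 2
  unfold sqNorm
  linarith

theorem hasDerivWithinAt_components {f : ℝ → H × H × H × H} {f' : H × H × H × H} {I : Set ℝ}
    {t : ℝ} (h : HasDerivWithinAt f f' I t) :
    HasDerivWithinAt (fun x => (f x).1) f'.1 I t ∧
      HasDerivWithinAt (fun x => (f x).2.1) f'.2.1 I t ∧
      HasDerivWithinAt (fun x => (f x).2.2.1) f'.2.2.1 I t ∧
      HasDerivWithinAt (fun x => (f x).2.2.2) f'.2.2.2 I t := by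
  have h1 := (ContinuousLinearMap.snd ℝ H (H × H × H)).hasFDerivAt.comp_hasDerivWithinAt t h
  have h2 := (ContinuousLinearMap.snd ℝ H (H × H)).hasFDerivAt.comp_hasDerivWithinAt t h1
  exact ⟨(ContinuousLinearMap.fst ℝ H (H × H × H)).hasFDerivAt.comp_hasDerivWithinAt t h,
    (ContinuousLinearMap.fst ℝ H (H × H)).hasFDerivAt.comp_hasDerivWithinAt t h1,
    (ContinuousLinearMap.fst ℝ H H).hasFDerivAt.comp_hasDerivWithinAt t h2,
    (ContinuousLinearMap.snd ℝ H H).hasFDerivAt.comp_hasDerivWithinAt t h2⟩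

/-! ### Solvability, uniqueness and decay in the new coordinates -/

section Main

variable {α β γ κ η s : ℝ}

set_option maxSynthPendingDepth 5 in
-- The bounded operators R n = (S + ε n)⁻¹ replace A^{1/2}, the groups exp(t G n) inherit the
-- uniform decay, and the limit is taken with the regularizer J = diag(S³).
theorem exists_decaying_semigroup [CompleteSpace H] (hα : 0 < α) (hη : η ≠ 0) (hκ : 0 < κ)
    (hγ : 0 < γ) (hs : 0 ≤ s) (hμ : 0 ≤ γ - α * β)
    (hcond : (γ - α * β) * (s ^ 4 + κ ^ 2 / α ^ 2) < κ * η ^ 2) {S : H →L[ℝ] H}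
    (hS : ∀ x y, ⟪S x, y⟫_ℝ = ⟪x, S y⟫_ℝ) (hSs : ∀ x, ‖S x‖ ≤ s * ‖x‖)
    (hpos : ∀ x, 0 ≤ ⟪S x, x⟫_ℝ) (hinj : ∀ x, S x = 0 → x = 0) :
    ∃ (V : ℝ → H × H × H × H → H × H × H × H) (M ω : ℝ), 0 < M ∧ 0 < ω ∧ (∀ x, V 0 x = x) ∧
      (∀ x, ContinuousOn (fun t => V t x) (Ici 0)) ∧
      (∀ x t, 0 ≤ t → HasDerivWithinAt (fun t => diag (S * S) (V t x))
        (generator α β (γ - α * β) κ η (S * S) S 1 (V t x)) (Ici 0) t) ∧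
      ∀ x t, 0 ≤ t → sqNorm (V t x).1 (V t x).2.1 (V t x).2.2.1 (V t x).2.2.2
        ≤ M * sqNorm x.1 x.2.1 x.2.2.1 x.2.2.2 * Real.exp (-ω * t) := by
  set μ := γ - α * β with hμd
  -- The condition is open, so it survives the slight increase of the norm bound from S to S + ε n.
  obtain ⟨s', hs', hcond'⟩ : ∃ s' > s, μ * (s' ^ 4 + κ ^ 2 / α ^ 2) < κ * η ^ 2 := by
    have hc : ContinuousAt (fun x : ℝ => μ * (x ^ 4 + κ ^ 2 / α ^ 2)) s := by fun_prop
    have h1 := (hc.eventually (Iio_mem_nhds hcond)).filter_mono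
      (nhdsWithin_le_nhds (s := Ioi s))
    obtain ⟨x, hx, hx'⟩ := (h1.and self_mem_nhdsWithin).exists
    exact ⟨x, hx', hx⟩
  obtain ⟨M, ω, hM, hω, hdecay⟩ := exists_uniform_decay (H := H) hα hη hκ hγ
    (hs.trans hs'.le) hμ hcond'
  set ε : ℕ → ℝ := fun n => (s' - s) / (n + 1) with hεd
  have hε : ∀ n, 0 < ε n := fun n => div_pos (sub_pos.2 hs') (by positivity)
  have hε1 : ∀ n, ε n ≤ s' - s := fun n =>
    div_le_self (sub_pos.2 hs').le (by linarith [n.cast_nonneg (α := ℝ)])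
  have hε0 : Tendsto ε atTop (𝓝 0) := by
    have := (tendsto_one_div_add_atTop_nhds_zero_nat (𝕜 := ℝ)).const_mul (s' - s)
    rw [mul_zero] at this
    exact this.congr fun n => by rw [hεd]; ring
  choose R hR hR' using fun n => exists_shift_inverse hpos (hε n)
  set G : ℕ → (H × H × H × H) →L[ℝ] (H × H × H × H) := fun n =>
    generator α β μ κ η 1 (R n) (R n * R n) with hG
  set U : ℕ → ℝ → (H × H × H × H) → (H × H × H × H) := fun n t x =>
    NormedSpace.exp (t • G n) x with hU
  have hUd : ∀ n x t, HasDerivAt (fun t => U n t x) (G n (U n t x)) t := fun n x t =>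
    hasDerivAt_exp_smul_apply (G n) x t
  have hU0 : ∀ n x, U n 0 x = x := fun n x => by simp [hU, NormedSpace.exp_zero]
  have hUdecay : ∀ n x t, 0 ≤ t → sqNorm (U n t x).1 (U n t x).2.1 (U n t x).2.2.1 (U n t x).2.2.2
      ≤ M * sqNorm x.1 x.2.1 x.2.2.1 x.2.2.2 * Real.exp (-ω * t) := by
    intro n x t ht
    set Q := S + ε n • (1 : H →L[ℝ] H) with hQ
    have hQR : ∀ z, Q (R n z) = z := fun z => congrArg (fun B : H →L[ℝ] H => B z) (hR' n)
    have hQS : ∀ x y, ⟪Q x, y⟫_ℝ = ⟪x, Q y⟫_ℝ := fun x y => by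
      simp [hQ, inner_add_left, inner_add_right, hS, real_inner_smul_left, real_inner_smul_right]
    have hQs : ∀ x, ‖Q x‖ ≤ s' * ‖x‖ := fun x => by
      have h1 : Q x = S x + ε n • x := rfl
      rw [h1]
      refine (norm_add_le _ _).trans ?_
      rw [norm_smul, Real.norm_of_nonneg (hε n).le]
      have := hSs x
      have := mul_le_mul_of_nonneg_right (hε1 n) (norm_nonneg x)
      linarith
    have hd : ∀ τ, HasDerivWithinAt (fun t => U n t x)
        (R n (U n τ x).2.2.1, (U n τ x).1 - α • (U n τ x).2.1,
          η • (R n * R n) (U n τ x).2.2.2 - R n (β • (U n τ x).1 + μ • (U n τ x).2.1),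
          -(R n * R n) (κ • (U n τ x).2.2.2 + η • (U n τ x).2.2.1)) (Ici 0) τ := fun τ => by
      have := (hUd n x τ).hasDerivWithinAt (s := Ici (0 : ℝ))
      rw [hG, generator_apply] at this
      exact this
    -- Since Q has the bounded inverse R n, every state is regular and the a priori estimate applies
    -- to all initial data.
    have h := hdecay Q hQS hQs (fun t => (U n t x).1) (fun t => (U n t x).2.1)
      (fun t => (U n t x).2.2.1) (fun t => (U n t x).2.2.2)
      (fun t => R n (R n (U n t x).2.2.1)) (fun t => R n (R n (U n t x).2.2.2))
      (fun t => R n (U n t x).1) (fun t => R n (U n t x).2.1)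
      (fun t _ => (hQR _).symm) (fun t _ => (hQR _).symm)
      (fun t _ => by rw [hQR, hQR]) (fun t _ => by rw [hQR, hQR])
      (fun t _ => by rw [hQR]; exact (hasDerivWithinAt_components (hd t)).1)
      (fun t _ => (hasDerivWithinAt_components (hd t)).2.1)
      (fun t _ => (hasDerivWithinAt_components (hd t)).2.2.1.congr_deriv (by
        simp only [mul_apply_eq_comp, map_add, map_smul]; abel))
      (fun t _ => (hasDerivWithinAt_components (hd t)).2.2.2.congr_deriv (by
        simp only [mul_apply_eq_comp, map_add, map_smul]; abel)) t ht
    simpa only [hU0] using h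
  have hK : ∀ n, ∀ t : ℝ, 0 ≤ t → ∀ x, ‖NormedSpace.exp (t • G n) x‖ ≤ √(4 * M) * ‖x‖ := by
    intro n t ht x
    refine le_of_sq_le_sq ?_ (by positivity)
    rw [mul_pow, Real.sq_sqrt (by positivity)]
    have h1 := hUdecay n x t ht
    have h2 := norm_sq_le_sqNorm (U n t x)
    have h3 := mul_le_mul_of_nonneg_left (sqNorm_le_norm_sq x) hM.le
    have h4 : Real.exp (-ω * t) ≤ 1 := Real.exp_le_one_iff.2 (by nlinarith)
    have h5 := mul_le_of_le_one_right
      (mul_nonneg hM.le (sqNorm_nonneg x.1 x.2.1 x.2.2.1 x.2.2.2)) h4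
    have h6 : ‖U n t x‖ ^ 2 ≤ M * (4 * ‖x‖ ^ 2) := h2.trans (h1.trans (h5.trans h3))
    exact h6.trans (le_of_eq (by ring))
  have hcommR : ∀ n, Commute S (R n) := fun n => by
    have hRS : R n * S = 1 - ε n • R n := by
      rw [eq_sub_iff_add_eq, ← hR n, mul_add, mul_smul_comm, mul_one]
    have hSR : S * R n = 1 - ε n • R n := by
      rw [eq_sub_iff_add_eq, ← hR' n, add_mul, smul_mul_assoc, one_mul]
    exact hSR.trans hRS.symm
  have hcommG : ∀ n, Commute (diag (S * S * S)) (G n) := fun n => by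
    have h1 : Commute (S * S * S) (R n) :=
      ((hcommR n).mul_left (hcommR n)).mul_left (hcommR n)
    have h2 : Commute (S * S * S) (R n * R n) := h1.mul_right h1
    change _ * _ = _ * _
    rw [hG, diag_mul_generator, generator_mul_diag, h1.eq, h2.eq, mul_one, one_mul]
  have hdense : DenseRange (diag (S * S * S)) := by
    have h1 := denseRange_of_symmetric_injective hS hinj
    have h3 : DenseRange (S * S * S : H →L[ℝ] H) :=
      (h1.comp h1 S.continuous).comp h1 (S.continuous.comp S.continuous)
    exact h3.prodMap (h3.prodMap (h3.prodMap h3))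
  obtain ⟨hl1, hl2⟩ := tendsto_shift_inverse hpos hε hε0 hR hR'
  have hlim : Tendsto (fun n => G n * diag (S * S * S)) atTop
      (𝓝 (generator α β μ κ η (S * S * S) (S * S) S)) := by
    have h1 := (continuous_generator (H := H) (α := α) (β := β) (μ := μ) (κ := κ) (η := η)).tendsto
      (S * S * S, S * S, S)
    refine (h1.comp ((tendsto_const_nhds (x := S * S * S)).prodMk_nhds
      (hl1.prodMk_nhds hl2))).congr fun n => ?_
    rw [hG, generator_mul_diag, one_mul]
    rfl
  obtain ⟨V, hV, hVc, hVd⟩ := exists_limit_semigroup (Real.sqrt_pos.2 (by positivity : 0 < 4 * M))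
    hK hcommG hdense hlim
  refine ⟨V, M, ω, hM, hω, fun x => ?_, hVc, fun x t ht => ?_, fun x t ht => ?_⟩
  · exact tendsto_nhds_unique (hV x 0 le_rfl)
      (tendsto_const_nhds.congr fun n => (hU0 n x).symm)
  -- The limit solves the equation after S³; injectivity of S and continuity of the right-hand side
  -- remove one factor.
  · refine hasDerivWithinAt_of_separating (ι := Unit) (fun _ => diag S) (fun y hy => ?_)
      (f' := fun t => generator α β μ κ η (S * S) S 1 (V t x))
      ((generator α β μ κ η (S * S) S 1).continuous.comp_continuousOn (hVc x))
      (fun _ t ht => ?_) ht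
    · have h1 := hy ()
      rw [diag_apply] at h1
      simp only [Prod.mk_eq_zero] at h1
      exact Prod.ext (hinj _ h1.1) (Prod.ext (hinj _ h1.2.1)
        (Prod.ext (hinj _ h1.2.2.1) (hinj _ h1.2.2.2)))
    · have h1 := hVd x t ht
      have h2 : generator α β μ κ η (S * S * S) (S * S) S
          = diag S * generator α β μ κ η (S * S) S 1 := by
        rw [diag_mul_generator, mul_one, mul_assoc]
      rw [h2] at h1
      exact h1
  · have h1 := hV x t ht
    have hc : Continuous fun y : H × H × H × H => sqNorm y.1 y.2.1 y.2.2.1 y.2.2.2 := by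
      unfold sqNorm; fun_prop
    exact le_of_tendsto ((hc.tendsto _).comp h1) (Eventually.of_forall fun n => hUdecay n x t ht)

/-- If d is the difference of two solutions, S²d solves the system with enough regularity for the a
priori estimate: its components ζ and θ have the form S²g and S²h with g, h the components of d. It
starts from 0, hence vanishes, and S is injective. -/
theorem eq_of_regularized_solutions (hα : 0 < α) (hη : η ≠ 0) (hκ : 0 < κ)
    (hγ : 0 < γ) (hs : 0 ≤ s) (hμ : 0 ≤ γ - α * β)
    (hcond : (γ - α * β) * (s ^ 4 + κ ^ 2 / α ^ 2) < κ * η ^ 2) {S : H →L[ℝ] H}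
    (hS : ∀ x y, ⟪S x, y⟫_ℝ = ⟪x, S y⟫_ℝ) (hSs : ∀ x, ‖S x‖ ≤ s * ‖x‖)
    (hinj : ∀ x, S x = 0 → x = 0) {y z : ℝ → H × H × H × H}
    (hy : ∀ t, 0 ≤ t → HasDerivWithinAt (fun t => diag (S * S) (y t))
        (generator α β (γ - α * β) κ η (S * S) S 1 (y t)) (Ici 0) t)
    (hz : ∀ t, 0 ≤ t → HasDerivWithinAt (fun t => diag (S * S) (z t))
        (generator α β (γ - α * β) κ η (S * S) S 1 (z t)) (Ici 0) t)
    (h0 : y 0 = z 0) {t : ℝ} (ht : 0 ≤ t) : y t = z t := by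
  obtain ⟨M, ω, hM, hω, hdecay⟩ := exists_uniform_decay (H := H) hα hη hκ hγ hs hμ hcond
  set d : ℝ → H × H × H × H := fun t => y t - z t with hd
  have hdd : ∀ t, 0 ≤ t → HasDerivWithinAt (fun t => diag (S * S) (d t))
      (S (d t).2.2.1, S (S ((d t).1 - α • (d t).2.1)),
        η • (d t).2.2.2 - S (β • (d t).1 + (γ - α * β) • (d t).2.1),
        -(κ • (d t).2.2.2 + η • (d t).2.2.1)) (Ici 0) t := by
    intro t ht
    have h1 := (hy t ht).sub (hz t ht)
    rw [← map_sub, generator_apply] at h1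
    exact h1.congr (fun x _ => map_sub _ _ _) (map_sub _ _ _)
  have h := hdecay S hS hSs (fun t => S (S (d t).1)) (fun t => S (S (d t).2.1))
      (fun t => S (S (d t).2.2.1)) (fun t => S (S (d t).2.2.2))
      (fun t => (d t).2.2.1) (fun t => (d t).2.2.2) (fun t => S (d t).1) (fun t => S (d t).2.1)
      (fun t _ => rfl) (fun t _ => rfl) (fun t _ => rfl) (fun t _ => rfl)
      (fun t ht => (hasDerivWithinAt_components (hdd t ht)).1)
      (fun t ht => (hasDerivWithinAt_components (hdd t ht)).2.1.congr_deriv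
        (by simp only [map_sub, map_smul]))
      (fun t ht => (hasDerivWithinAt_components (hdd t ht)).2.2.1.congr_deriv
        (by simp only [map_add, map_smul]; abel))
      (fun t ht => (hasDerivWithinAt_components (hdd t ht)).2.2.2.congr_deriv (neg_add' _ _)) t ht
  have hd0 : d 0 = 0 := sub_eq_zero.2 h0
  have hle : sqNorm (S (S (d t).1)) (S (S (d t).2.1)) (S (S (d t).2.2.1))
      (S (S (d t).2.2.2)) ≤ 0 := by
    refine h.trans (le_of_eq ?_)
    simp [hd0, sqNorm]
  have hdiag : diag (S * S) (d t) = 0 := by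
    have h1 := (norm_sq_le_sqNorm (diag (S * S) (d t))).trans hle
    simpa using le_antisymm h1 (sq_nonneg _)
  rw [diag_apply] at hdiag
  simp only [Prod.mk_eq_zero] at hdiag
  exact sub_eq_zero.1 (Prod.ext (hinj _ (hinj _ hdiag.1)) (Prod.ext (hinj _ (hinj _ hdiag.2.1))
    (Prod.ext (hinj _ (hinj _ hdiag.2.2.1)) (hinj _ (hinj _ hdiag.2.2.2)))))

end Main

/-! ### The spectral gap -/

section Spectrum

/-- The inverse B of A - z is bounded, symmetric and nonnegative, so ⟨y, By⟩ ≥ K⁻¹‖By‖² with K = ‖B‖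
+ 1. For y = (A - z)x this is a gain of K⁻¹ in the lower bound. -/
theorem exists_larger_lower_bound [CompleteSpace H] {A : H →ₗ.[ℝ] H} (hA : IsSelfAdjoint A) {z : ℝ}
    (hz : ∀ x : A.domain, z * ‖(x : H)‖ ^ 2 ≤ ⟪A x, (x : H)⟫_ℝ) (hres : InResolventSet A z) :
    ∃ δ > 0, ∀ x : A.domain, (z + δ) * ‖(x : H)‖ ^ 2 ≤ ⟪A x, (x : H)⟫_ℝ := by
  obtain ⟨B, hB1, hB2⟩ := hres
  choose hdom hB1 using hB1
  have hAB : ∀ y, A ⟨B y, hdom y⟩ = y + z • B y := fun y => sub_eq_iff_eq_add.1 (hB1 y)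
  have hpos : ∀ y, 0 ≤ ⟪y, B y⟫_ℝ := fun y => by
    have h := hz ⟨B y, hdom y⟩
    rw [hAB, inner_add_left, real_inner_smul_left, real_inner_self_eq_norm_sq] at h
    linarith
  have hsymm : ∀ x y, ⟪B x, y⟫_ℝ = ⟪x, B y⟫_ℝ := fun x y => by
    have h := graph_symm hA (A.mem_graph ⟨B x, hdom x⟩) (A.mem_graph ⟨B y, hdom y⟩)
    rw [hAB, hAB, inner_add_left, inner_add_right, real_inner_smul_left,
      real_inner_smul_right] at h
    linarith
  have hK : 0 < ‖B‖ + 1 := by positivity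
  refine ⟨(‖B‖ + 1)⁻¹, inv_pos.2 hK, fun x => ?_⟩
  set K := ‖B‖ + 1 with hKd
  set y := A x - z • (x : H) with hy
  have hBy : B y = x := hB2 x
  -- Positivity of B at this vector replaces a square root of B in the proof of ⟨y, By⟩ ≥ K⁻¹‖By‖².
  have h1 := hpos (y - K⁻¹ • B y)
  have h2 : ⟪B y, B (B y)⟫_ℝ ≤ K * ‖B y‖ ^ 2 := by
    refine (real_inner_le_norm _ _).trans ?_
    have := mul_le_mul_of_nonneg_left (B.le_opNorm (B y)) (norm_nonneg (B y))
    have := sq_nonneg ‖B y‖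
    rw [hKd]
    linarith
  simp only [map_sub, map_smul, inner_sub_left, inner_sub_right, real_inner_smul_left,
    real_inner_smul_right, ← hsymm y (B y), real_inner_self_eq_norm_sq] at h1
  have h3 := mul_le_mul_of_nonneg_left h2 (by positivity : 0 ≤ K⁻¹ * K⁻¹)
  have h4 : K⁻¹ * K⁻¹ * (K * ‖B y‖ ^ 2) = K⁻¹ * ‖B y‖ ^ 2 := by field_simp
  have h5 : K⁻¹ * ‖(x : H)‖ ^ 2 ≤ ⟪y, (x : H)⟫_ℝ := by
    rw [← hBy]; linarith
  rw [hy, inner_sub_left, real_inner_smul_left, real_inner_self_eq_norm_sq] at h5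
  linarith

/-- The largest lower bound of the form not exceeding lam is attained; were it below lam, it would
lie in the resolvent set and could be increased. -/
theorem lower_bound_of_forall_inResolventSet [CompleteSpace H] {A : H →ₗ.[ℝ] H}
    (hA : IsSelfAdjoint A) {c lam : ℝ}
    (hc : ∀ x : A.domain, c * ‖(x : H)‖ ^ 2 ≤ ⟪A x, (x : H)⟫_ℝ)
    (hres : ∀ z < lam, InResolventSet A z) (x : A.domain) :
    lam * ‖(x : H)‖ ^ 2 ≤ ⟪A x, (x : H)⟫_ℝ := by
  set Z : Set ℝ := {z | z ≤ lam ∧ ∀ x : A.domain, z * ‖(x : H)‖ ^ 2 ≤ ⟪A x, (x : H)⟫_ℝ} with hZ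
  have hne : Z.Nonempty := ⟨min c lam, min_le_right _ _, fun x =>
    (mul_le_mul_of_nonneg_right (min_le_left _ _) (sq_nonneg _)).trans (hc x)⟩
  have hbdd : BddAbove Z := ⟨lam, fun z hz => hz.1⟩
  have hclosed : IsClosed Z := by
    have : Z = Iic lam ∩ ⋂ x : A.domain, {z | z * ‖(x : H)‖ ^ 2 ≤ ⟪A x, (x : H)⟫_ℝ} := by
      ext z; simp [hZ]
    rw [this]
    exact isClosed_Iic.inter (isClosed_iInter fun x => isClosed_le (by fun_prop) continuous_const)
  have hm := hclosed.csSup_mem hne hbdd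
  rcases hm.1.eq_or_lt with h | h
  · rw [← h]; exact hm.2 x
  · obtain ⟨δ, hδ, hδ'⟩ := exists_larger_lower_bound hA hm.2 (hres _ h)
    have h1 : min (sSup Z + δ) lam ≤ sSup Z := le_csSup hbdd ⟨min_le_right _ _, fun x =>
      (mul_le_mul_of_nonneg_right (min_le_left _ _) (sq_nonneg _)).trans (hδ' x)⟩
    rcases min_le_iff.1 h1 with h2 | h2 <;> linarith

/-- The inverse of `A^{1/2}`. -/
theorem exists_inverse_posSqrt [CompleteSpace H] {A : H →ₗ.[ℝ] H} (hA : IsSelfAdjoint A)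
    (hpos : ∃ c > 0, ∀ x : A.domain, c * ‖(x : H)‖ ^ 2 ≤ ⟪A x, (x : H)⟫_ℝ) :
    ∃ S : H →L[ℝ] H, (∀ x y, ⟪S x, y⟫_ℝ = ⟪x, S y⟫_ℝ) ∧ (∀ x, 0 ≤ ⟪S x, x⟫_ℝ) ∧
      (∀ x, S x = 0 → x = 0) ∧ (∀ x y, (x, y) ∈ (posSqrt A).graph ↔ x = S y) ∧
      ∀ x y, (x, y) ∈ A.graph ↔ x = S (S y) := by
  obtain ⟨hR, hRp, hRA⟩ := isPosSqrt_posSqrt hA hpos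
  obtain ⟨c, hc, hpos⟩ := hpos
  have hi : ∀ x, (x, (0 : H)) ∈ (posSqrt A).graph → x = 0 := by
    intro x hx
    obtain ⟨x', rfl, h⟩ := (LinearPMap.mem_graph_iff A).1
      ((hRA x 0).2 ⟨0, hx, (posSqrt A).graph.zero_mem⟩)
    have h1 := hpos x'
    simp only at h
    rw [h, inner_zero_left] at h1
    have h2 : ‖(x' : H)‖ ^ 2 ≤ 0 := nonpos_of_mul_nonpos_right h1 hc
    simpa using h2
  have hs : ∀ y, ∃ x, (x, y) ∈ (posSqrt A).graph := fun y => by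
    obtain ⟨x, hx⟩ := surjective_of_strictlyPositive hA hc hpos y
    obtain ⟨z, _, hz⟩ := (hRA x y).1 hx
    exact ⟨z, hz⟩
  obtain ⟨S, hS, hSR⟩ := exists_inverse hR hi hs
  refine ⟨S, hS.isSymmetric, fun y => ?_, fun y hy => ?_, hSR, fun x y => ?_⟩
  · obtain ⟨x', hx, hy⟩ := (LinearPMap.mem_graph_iff _).1 ((hSR _ y).2 rfl)
    have h1 := hRp x'
    simp only at hx hy
    rwa [hx, hy, real_inner_comm] at h1
  · exact LinearPMap.graph_fst_eq_zero_snd _ ((hSR _ y).2 rfl) hy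
  · rw [hRA]
    constructor
    · rintro ⟨z, h1, h2⟩
      rw [(hSR _ _).1 h1, (hSR _ _).1 h2]
    · rintro rfl
      exact ⟨S y, (hSR _ _).2 rfl, (hSR _ _).2 rfl⟩

/-- A - z = (1 - zA⁻¹)A, and 1 - zA⁻¹ is invertible for z ≤ 0. This yields λ₁ > 0. -/
theorem inResolventSet_of_nonpos [CompleteSpace H] {A : H →ₗ.[ℝ] H} {S : H →L[ℝ] H}
    (hS : ∀ x y, ⟪S x, y⟫_ℝ = ⟪x, S y⟫_ℝ) (hSA : ∀ x y, (x, y) ∈ A.graph ↔ x = S (S y))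
    {z : ℝ} (hz : z ≤ 0) : InResolventSet A z := by
  have hp : ∀ x, 0 ≤ ⟪((-z) • (S * S)) x, x⟫_ℝ := fun x => by
    have h1 : ⟪((-z) • (S * S)) x, x⟫_ℝ = -z * ⟪S (S x), x⟫_ℝ := real_inner_smul_left _ _ _
    rw [h1, hS, real_inner_self_eq_norm_sq]
    exact mul_nonneg (neg_nonneg.2 hz) (sq_nonneg _)
  obtain ⟨R, hR, hR'⟩ := exists_shift_inverse hp one_pos
  have e1 : ∀ y, R ((-z) • S (S y) + (1 : ℝ) • y) = y := fun y =>
    congrArg (fun B : H →L[ℝ] H => B y) hR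
  have e2 : ∀ y, (-z) • S (S (R y)) + (1 : ℝ) • R y = y := fun y =>
    congrArg (fun B : H →L[ℝ] H => B y) hR'
  refine ⟨S * S * R, fun y => ?_, fun x => ?_⟩
  · obtain ⟨x', hx, hy⟩ := (LinearPMap.mem_graph_iff A).1 ((hSA _ (R y)).2 rfl)
    simp only at hx hy
    have hx' : (x' : H) = (S * S * R) y := hx
    refine ⟨hx' ▸ x'.2, ?_⟩
    have h2 : (⟨(S * S * R) y, hx' ▸ x'.2⟩ : A.domain) = x' := Subtype.ext hx'.symm
    rw [h2, hy]
    have h3 := e2 y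
    rw [one_smul, neg_smul] at h3
    refine Eq.trans ?_ h3
    simp only [mul_apply_eq_comp]
    abel
  · have h1 := (hSA _ _).1 (A.mem_graph x)
    have h2 := e1 (A x)
    rw [← h1] at h2
    have h3 : A x - z • (x : H) = (-z) • (x : H) + (1 : ℝ) • A x := by
      rw [one_smul, neg_smul]; abel
    rw [h3, mul_apply_eq_comp, h2]
    exact h1.symm

/-- ‖Sx‖² = ⟨x, A⁻¹x⟩ ≤ ‖x‖ ‖A⁻¹x‖ ≤ lam⁻¹‖x‖². -/
theorem norm_inverse_sqrt_le [CompleteSpace H] {A : H →ₗ.[ℝ] H} {S : H →L[ℝ] H}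
    (hS : ∀ x y, ⟪S x, y⟫_ℝ = ⟪x, S y⟫_ℝ) (hSA : ∀ x y, (x, y) ∈ A.graph ↔ x = S (S y))
    {lam : ℝ} (hlam : 0 < lam) (hA : ∀ x : A.domain, lam * ‖(x : H)‖ ^ 2 ≤ ⟪A x, (x : H)⟫_ℝ)
    (x : H) : ‖S x‖ ≤ (√lam)⁻¹ * ‖x‖ := by
  obtain ⟨x', hx, hy⟩ := (LinearPMap.mem_graph_iff A).1 ((hSA _ x).2 rfl)
  simp only at hx hy
  have h1 := hA x'
  rw [hx, hy] at h1
  have h2 : ⟪x, S (S x)⟫_ℝ = ‖S x‖ ^ 2 := by rw [← hS, real_inner_self_eq_norm_sq]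
  have h3 : ‖S x‖ ^ 2 ≤ ‖x‖ * ‖S (S x)‖ := by rw [← h2]; exact real_inner_le_norm _ _
  have h4 : lam * ‖S (S x)‖ ≤ ‖x‖ := by
    rcases (norm_nonneg (S (S x))).eq_or_lt with h0 | h0
    · rw [← h0, mul_zero]; exact norm_nonneg _
    · rw [h2] at h1
      refine le_of_mul_le_mul_right ?_ h0
      linarith
  refine le_of_sq_le_sq ?_ (by positivity)
  rw [mul_pow, inv_pow, Real.sq_sqrt hlam.le, inv_mul_eq_div, le_div_iff₀ hlam]
  have h5 := mul_le_mul_of_nonneg_left h4 (norm_nonneg x)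
  have h6 := mul_le_mul_of_nonneg_right h3 hlam.le
  linarith

/-- In the first case κ𝔱(κ) exceeds λ₁⁻² + κ²/α² by the square (1/λ₁ - κ/α)²; in the second, 1/λ₁ ≤
κ/α. The condition used in the proof is thus no stronger than the threshold. -/
theorem threshold_condition {α κ η lam μ : ℝ} (hα : 0 < α) (hκ : 0 < κ) (hlam : 0 < lam)
    (hμ : 0 ≤ μ) (h : threshold α lam κ * μ < η ^ 2) :
    μ * (((√lam)⁻¹) ^ 4 + κ ^ 2 / α ^ 2) < κ * η ^ 2 := by
  have h4 : ((√lam)⁻¹) ^ 4 = 1 / lam ^ 2 := by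
    rw [inv_pow, show (4 : ℕ) = 2 * 2 from rfl, pow_mul, Real.sq_sqrt hlam.le, one_div]
  rw [h4]
  have h1 : 1 / lam ^ 2 + κ ^ 2 / α ^ 2 ≤ κ * threshold α lam κ := by
    unfold threshold
    split_ifs with hc
    · have e : κ * (2 * κ / α ^ 2 * (1 - α / (κ * lam) + α ^ 2 / (κ ^ 2 * lam ^ 2)))
          = 1 / lam ^ 2 + κ ^ 2 / α ^ 2 + (1 / lam - κ / α) ^ 2 := by
        field_simp; ring
      rw [e]
      linarith [sq_nonneg (1 / lam - κ / α)]
    · rw [not_lt, div_le_iff₀ hlam] at hc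
      have h5 : 1 / lam ≤ κ / α := by rw [div_le_div_iff₀ hlam hα]; linarith
      have h6 : (1 / lam) ^ 2 ≤ (κ / α) ^ 2 := pow_le_pow_left₀ (by positivity) h5 2
      have e : κ * (2 * κ / α ^ 2) = (κ / α) ^ 2 + κ ^ 2 / α ^ 2 := by ring
      rw [div_pow, one_pow] at h6
      rw [e]
      linarith
  calc μ * (1 / lam ^ 2 + κ ^ 2 / α ^ 2) ≤ μ * (κ * threshold α lam κ) :=
        mul_le_mul_of_nonneg_left h1 hμ
    _ = κ * (threshold α lam κ * μ) := by ring
    _ < κ * η ^ 2 := mul_lt_mul_of_pos_left h hκ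

theorem exists_domain_eq {A : H →ₗ.[ℝ] H} {S : H →L[ℝ] H}
    (hSA : ∀ x y, (x, y) ∈ A.graph ↔ x = S (S y)) (ψ : H) :
    ∃ φ : A.domain, (φ : H) = S (S ψ) ∧ A φ = ψ := by
  obtain ⟨φ, h1, h2⟩ := (LinearPMap.mem_graph_iff A).1 ((hSA _ ψ).2 rfl)
  exact ⟨φ, h1, h2⟩

end Spectrum

/-! ### Change of coordinates -/

section Coordinates

variable [CompleteSpace H] {A : H →ₗ.[ℝ] H} {S : H →L[ℝ] H} {α β γ κ η : ℝ}

/-- The coordinates `(A^{1/2}(v + α u), A^{1/2} u, w + α v, θ)` of a phase point. -/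
noncomputable def toState (α : ℝ) (U : PhaseSpace A) : H × H × H × H :=
  (posSqrt A (U.v + α • U.u), posSqrt A U.u, U.w + α • (U.v : H), U.θ)

/-- The phase point with given coordinates. -/
noncomputable def ofState (α : ℝ) (S : H →L[ℝ] H) (hdom : ∀ y, S y ∈ (posSqrt A).domain)
    (y : H × H × H × H) : PhaseSpace A where
  u := ⟨S y.2.1, hdom _⟩
  v := ⟨S (y.1 - α • y.2.1), hdom _⟩
  w := y.2.2.1 - α • S (y.1 - α • y.2.1)
  θ := y.2.2.2

theorem inverse_posSqrt_apply (hSR : ∀ x y, (x, y) ∈ (posSqrt A).graph ↔ x = S y)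
    (x : (posSqrt A).domain) : S (posSqrt A x) = x :=
  ((hSR _ _).1 ((posSqrt A).mem_graph x)).symm

theorem mem_domain_posSqrt (hSR : ∀ x y, (x, y) ∈ (posSqrt A).graph ↔ x = S y) (y : H) :
    S y ∈ (posSqrt A).domain :=
  LinearPMap.mem_domain_of_mem_graph ((hSR _ y).2 rfl)

theorem posSqrt_inverse_apply (hSR : ∀ x y, (x, y) ∈ (posSqrt A).graph ↔ x = S y)
    (hinj : ∀ x, S x = 0 → x = 0) (y : H) (h : S y ∈ (posSqrt A).domain) :
    posSqrt A ⟨S y, h⟩ = y := by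
  refine sub_eq_zero.1 (hinj _ ?_)
  rw [map_sub, inverse_posSqrt_apply hSR, sub_self]

theorem ofState_toState (hSR : ∀ x y, (x, y) ∈ (posSqrt A).graph ↔ x = S y)
    (hdom : ∀ y, S y ∈ (posSqrt A).domain) (U : PhaseSpace A) :
    ofState α S hdom (toState α U) = U := by
  have h1 : posSqrt A (U.v + α • U.u) - α • posSqrt A U.u = posSqrt A U.v := by
    rw [LinearPMap.map_add, LinearPMap.map_smul, add_sub_cancel_right]
  obtain ⟨u, v, w, θ⟩ := U
  simp only [ofState, toState, h1, inverse_posSqrt_apply hSR, add_sub_cancel_right]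

theorem toState_ofState (hSR : ∀ x y, (x, y) ∈ (posSqrt A).graph ↔ x = S y)
    (hinj : ∀ x, S x = 0 → x = 0) (hdom : ∀ y, S y ∈ (posSqrt A).domain) (y : H × H × H × H) :
    toState α (ofState α S hdom y) = y := by
  simp only [toState, ofState, LinearPMap.map_add, LinearPMap.map_smul,
    posSqrt_inverse_apply hSR hinj, sub_add_cancel]

theorem energy_eq (U : PhaseSpace A) :
    energy A α U = 1 / 2 * (‖(toState α U).1‖ ^ 2 + ‖(toState α U).2.2.1‖ ^ 2 +
      ‖(toState α U).1 - α • (toState α U).2.1‖ ^ 2 + ‖(toState α U).2.2.2‖ ^ 2) := by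
  have h1 : posSqrt A (U.v + α • U.u) - α • posSqrt A U.u = posSqrt A U.v := by
    rw [LinearPMap.map_add, LinearPMap.map_smul, add_sub_cancel_right]
  simp only [energy, toState, h1]

theorem energy_le (U : PhaseSpace A) :
    energy A α U ≤ (3 / 2 + α ^ 2) * sqNorm (toState α U).1 (toState α U).2.1
      (toState α U).2.2.1 (toState α U).2.2.2 := by
  rw [energy_eq]
  obtain ⟨p, a, ζ, θ⟩ := toState α U
  have h := norm_sub_sq_le p (α • a)
  rw [norm_smul, mul_pow, Real.norm_eq_abs, sq_abs] at h
  have h1 : 0 ≤ α ^ 2 * (‖p‖ ^ 2 + ‖ζ‖ ^ 2 + ‖θ‖ ^ 2) := by positivity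
  have := sq_nonneg ‖a‖
  have := sq_nonneg ‖ζ‖
  have := sq_nonneg ‖θ‖
  simp only [sqNorm]
  linarith

/-- The energy has no term in a alone, but αa = p - (p - αa) recovers it. -/
theorem sqNorm_toState_le (hα : 0 < α) (U : PhaseSpace A) :
    sqNorm (toState α U).1 (toState α U).2.1 (toState α U).2.2.1 (toState α U).2.2.2
      ≤ (2 + 4 / α ^ 2) * energy A α U := by
  rw [energy_eq]
  obtain ⟨p, a, ζ, θ⟩ := toState α U
  have h := norm_sub_sq_le p (p - α • a)
  rw [sub_sub_cancel, norm_smul, mul_pow, Real.norm_eq_abs, sq_abs] at h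
  have h1 : ‖a‖ ^ 2 ≤ 1 / α ^ 2 * (2 * ‖p‖ ^ 2 + 2 * ‖p - α • a‖ ^ 2) := by
    rw [div_mul_eq_mul_div, one_mul, le_div_iff₀ (by positivity)]
    linarith
  have h2 : 0 ≤ 1 / α ^ 2 * (‖ζ‖ ^ 2 + ‖θ‖ ^ 2) := by positivity
  have := sq_nonneg ‖p - α • a‖
  have e : (2 + 4 / α ^ 2) * (1 / 2 * (‖p‖ ^ 2 + ‖ζ‖ ^ 2 + ‖p - α • a‖ ^ 2 + ‖θ‖ ^ 2))
      = ‖p‖ ^ 2 + ‖ζ‖ ^ 2 + ‖p - α • a‖ ^ 2 + ‖θ‖ ^ 2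
        + 1 / α ^ 2 * (2 * ‖p‖ ^ 2 + 2 * ‖p - α • a‖ ^ 2)
        + 2 * (1 / α ^ 2 * (‖ζ‖ ^ 2 + ‖θ‖ ^ 2)) := by ring
  simp only [sqNorm]
  rw [e]
  linarith

/-- Testing with φ = A⁻¹ψ, ψ arbitrary, makes the weak equations statements about the scalar
products of A⁻¹ζ and A⁻¹θ with ψ. The right-hand sides are continuous, so these combine into
derivatives in H. -/
theorem IsWeakSolution.hasDerivWithinAt_regularized
    (hS : ∀ x y, ⟪S x, y⟫_ℝ = ⟪x, S y⟫_ℝ)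
    (hSR : ∀ x y, (x, y) ∈ (posSqrt A).graph ↔ x = S y)
    (hSA : ∀ x y, (x, y) ∈ A.graph ↔ x = S (S y)) {U : ℝ → PhaseSpace A}
    (hU : IsWeakSolution A α β γ κ η U) {t : ℝ} (ht : 0 ≤ t) :
    HasDerivWithinAt (fun t => diag (S * S) (toState α (U t)))
      (generator α β (γ - α * β) κ η (S * S) S 1 (toState α (U t))) (Ici 0) t := by
  have hz : ∀ t, S (posSqrt A ((U t).v + α • (U t).u)) = ((U t).v : H) + α • ((U t).u : H) :=
    fun t => inverse_posSqrt_apply hSR _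
  have hu : ∀ t, S (posSqrt A (U t).u) = (U t).u := fun t => inverse_posSqrt_apply hSR _
  have hcv : ContinuousOn (fun t => ((U t).v : H)) (Ici 0) := fun t ht =>
    (hU.deriv_v t ht).continuousWithinAt
  have hcu : ContinuousOn (fun t => ((U t).u : H)) (Ici 0) := fun t ht =>
    (hU.deriv_u t ht).continuousWithinAt
  have d1 : HasDerivWithinAt (fun t => S (((U t).v : H) + α • ((U t).u : H)))
      (S ((U t).w + α • ((U t).v : H))) (Ici 0) t :=
    S.hasFDerivAt.comp_hasDerivWithinAt t ((hU.deriv_v t ht).add ((hU.deriv_u t ht).const_smul α))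
  have d2 : HasDerivWithinAt (fun t => S ((U t).u : H)) (S ((U t).v : H)) (Ici 0) t :=
    S.hasFDerivAt.comp_hasDerivWithinAt t (hU.deriv_u t ht)
  have hsep : ∀ x : H, (∀ ψ : H, innerSL ℝ ψ x = 0) → x = 0 := fun x h =>
    inner_self_eq_zero (𝕜 := ℝ).1 (h x)
  have d3 : HasDerivWithinAt (fun t => S (S ((U t).w + α • ((U t).v : H))))
      (η • (U t).θ - β • ((U t).v : H) - γ • ((U t).u : H)) (Ici 0) t := by
    refine hasDerivWithinAt_of_separating (fun ψ : H => innerSL ℝ ψ) hsep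
      (f' := fun t => η • (U t).θ - β • ((U t).v : H) - γ • ((U t).u : H))
      (((hU.continuousOn_θ.const_smul η).sub (hcv.const_smul β)).sub (hcu.const_smul γ))
      (fun ψ t ht => ?_) ht
    obtain ⟨φ, hφ, hAφ⟩ := exists_domain_eq hSA ψ
    have h1 := (hU.deriv_w φ t ht).add
      (((hU.deriv_v t ht).inner ℝ (hasDerivWithinAt_const t _ (φ : H))).const_mul α)
    rw [hAφ] at h1
    refine (h1.congr (fun x _ => ?_) ?_).congr_deriv ?_
    · simp [innerSL_apply_apply, ← hS, ← hφ, inner_add_right, real_inner_smul_right,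
        real_inner_comm (φ : H)]
    · simp [innerSL_apply_apply, ← hS, ← hφ, inner_add_right, real_inner_smul_right,
        real_inner_comm (φ : H)]
    · simp only [innerSL_apply_apply, inner_sub_right, real_inner_smul_right, real_inner_comm ψ,
        inner_zero_right]
      ring
  have d4 : HasDerivWithinAt (fun t => S (S (U t).θ))
      (-(κ • (U t).θ + η • ((U t).w + α • ((U t).v : H)))) (Ici 0) t := by
    refine hasDerivWithinAt_of_separating (fun ψ : H => innerSL ℝ ψ) hsep
      (f' := fun t => -(κ • (U t).θ + η • ((U t).w + α • ((U t).v : H))))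
      (((hU.continuousOn_θ.const_smul κ).add
        ((hU.continuousOn_w.add (hcv.const_smul α)).const_smul η)).neg)
      (fun ψ t ht => ?_) ht
    obtain ⟨φ, hφ, hAφ⟩ := exists_domain_eq hSA ψ
    have h1 := hU.deriv_θ φ t ht
    rw [hAφ] at h1
    refine (h1.congr (fun x _ => ?_) ?_).congr_deriv ?_
    · simp [innerSL_apply_apply, ← hS, ← hφ, real_inner_comm (φ : H)]
    · simp [innerSL_apply_apply, ← hS, ← hφ, real_inner_comm (φ : H)]
    · simp only [innerSL_apply_apply, inner_neg_right, inner_add_right, real_inner_smul_right,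
        real_inner_comm ψ]
      ring
  have hd := d1.prodMk (d2.prodMk (d3.prodMk d4))
  refine (hd.congr (fun x _ => ?_) ?_).congr_deriv ?_
  · simp only [diag_apply, toState, mul_apply_eq_comp, hz, hu]
  · simp only [diag_apply, toState, mul_apply_eq_comp, hz, hu]
  · simp only [generator_apply, toState, mul_apply_eq_comp, map_sub, map_add, map_smul, hz, hu,
      one_apply_eq_self]
    refine Prod.ext rfl (Prod.ext ?_ (Prod.ext ?_ rfl))
    · simp
    · simp only [smul_add, sub_smul, smul_smul, mul_comm β α]
      abel

/-- The converse direction: φ = S²Aφ moves the regularizer onto the solution, and u, v are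
differentiated after cancelling one injective factor S. -/
theorem isWeakSolution_ofState
    (hS : ∀ x y, ⟪S x, y⟫_ℝ = ⟪x, S y⟫_ℝ) (hinj : ∀ x, S x = 0 → x = 0)
    (hSR : ∀ x y, (x, y) ∈ (posSqrt A).graph ↔ x = S y)
    (hSA : ∀ x y, (x, y) ∈ A.graph ↔ x = S (S y)) (hdom : ∀ y, S y ∈ (posSqrt A).domain)
    {y : ℝ → H × H × H × H} (hc : ContinuousOn y (Ici 0))
    (hy : ∀ t, 0 ≤ t → HasDerivWithinAt (fun t => diag (S * S) (y t))
        (generator α β (γ - α * β) κ η (S * S) S 1 (y t)) (Ici 0) t) :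
    IsWeakSolution A α β γ κ η (fun t => ofState α S hdom (y t)) := by
  have hcp : ContinuousOn (fun t => (y t).1) (Ici 0) := hc.fst
  have hca : ContinuousOn (fun t => (y t).2.1) (Ici 0) := hc.snd.fst
  have hcζ : ContinuousOn (fun t => (y t).2.2.1) (Ici 0) := hc.snd.snd.fst
  have hcθ : ContinuousOn (fun t => (y t).2.2.2) (Ici 0) := hc.snd.snd.snd
  have hcb : ContinuousOn (fun t => (y t).1 - α • (y t).2.1) (Ici 0) := hcp.sub (hca.const_smul α)
  have hd := fun t ht => hasDerivWithinAt_components (hy t ht)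
  simp only [generator_apply, diag_apply, mul_apply_eq_comp, one_apply_eq_self] at hd
  have du : ∀ t, 0 ≤ t → HasDerivWithinAt (fun t => S (y t).2.1)
      (S ((y t).1 - α • (y t).2.1)) (Ici 0) t := fun t ht =>
    hasDerivWithinAt_of_separating (ι := Unit) (fun _ => S) (fun x h => hinj x (h ()))
      (f' := fun t => S ((y t).1 - α • (y t).2.1)) (S.continuous.comp_continuousOn hcb)
      (fun _ t ht => (hd t ht).2.1) ht
  have dz : ∀ t, 0 ≤ t → HasDerivWithinAt (fun t => S (y t).1) (y t).2.2.1 (Ici 0) t :=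
    fun t ht => hasDerivWithinAt_of_separating (ι := Unit) (fun _ => S)
      (fun x h => hinj x (h ())) (f' := fun t => (y t).2.2.1) hcζ (fun _ t ht => (hd t ht).1) ht
  have dv : ∀ t, 0 ≤ t → HasDerivWithinAt (fun t => S ((y t).1 - α • (y t).2.1))
      ((y t).2.2.1 - α • S ((y t).1 - α • (y t).2.1)) (Ici 0) t := fun t ht => by
    have h := (dz t ht).sub ((du t ht).const_smul α)
    refine h.congr (fun x _ => ?_) ?_ <;> simp
  refine ⟨?_, ?_, ?_, hcθ, du, dv, fun φ t ht => ?_, fun φ t ht => ?_⟩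
  · simpa only [ofState, posSqrt_inverse_apply hSR hinj] using hca
  · simpa only [ofState, posSqrt_inverse_apply hSR hinj] using hcb
  · exact hcζ.sub ((S.continuous.comp_continuousOn hcb).const_smul α)
  · have hφ := (hSA _ _).1 (A.mem_graph φ)
    have h1 := (((hd t ht).2.2.1).inner ℝ (hasDerivWithinAt_const t _ (A φ))).sub
      (((dv t ht).inner ℝ (hasDerivWithinAt_const t _ (φ : H))).const_mul α)
    refine (h1.congr (fun x _ => ?_) ?_).congr_deriv ?_
    · simp [ofState, inner_sub_left, real_inner_smul_left, hS, ← hφ]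
    · simp [ofState, inner_sub_left, real_inner_smul_left, hS, ← hφ]
    · simp only [ofState, map_sub, map_add, map_smul, inner_sub_left, inner_add_left,
        real_inner_smul_left, inner_zero_right]
      ring
  · have hφ := (hSA _ _).1 (A.mem_graph φ)
    have h1 := ((hd t ht).2.2.2).inner ℝ (hasDerivWithinAt_const t _ (A φ))
    refine (h1.congr (fun x _ => ?_) ?_).congr_deriv ?_
    · simp [ofState, hS, ← hφ]
    · simp [ofState, hS, ← hφ]
    · simp only [ofState, inner_neg_left, inner_sub_left, inner_add_left,
        real_inner_smul_left, inner_zero_right]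
      ring

end Coordinates

/-! ### Assembly of the stability theorem. -/

theorem exponentiallyStable_of_threshold_lt [CompleteSpace H] {A : H →ₗ.[ℝ] H}
    (hA : IsSelfAdjoint A)
    (hpos : ∃ c > 0, ∀ x : A.domain, c * ‖(x : H)‖ ^ 2 ≤ ⟪A x, (x : H)⟫_ℝ) {lam₁ : ℝ}
    (hlam₁ : IsLeast (spectrumSet A) lam₁) {α β γ κ η : ℝ} (hα : 0 < α)
    (hγ : 0 < γ) (hκ : 0 < κ) (hμ : 0 ≤ γ - α * β)
    (hη : threshold α lam₁ κ * (γ - α * β) < η ^ 2) : ExponentiallyStable A α β γ κ η := by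
  obtain ⟨S, hS, hSp, hinj, hSR, hSA⟩ := exists_inverse_posSqrt hA hpos
  have hlam : 0 < lam₁ := by
    by_contra h
    exact hlam₁.1 (inResolventSet_of_nonpos hS hSA (not_lt.1 h))
  have hres : ∀ z < lam₁, InResolventSet A z := fun z hz => by
    by_contra h
    exact absurd (hlam₁.2 h) (not_le.2 hz)
  obtain ⟨c, -, hc⟩ := hpos
  have hSs := norm_inverse_sqrt_le hS hSA hlam
    (lower_bound_of_forall_inResolventSet hA hc hres)
  have hcond := threshold_condition hα hκ hlam hμ hη
  have hη0 : η ≠ 0 := by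
    rintro rfl
    have : 0 ≤ (γ - α * β) * (((√lam₁)⁻¹) ^ 4 + κ ^ 2 / α ^ 2) := by positivity
    rw [zero_pow two_ne_zero, mul_zero] at hcond
    linarith
  have hs : 0 ≤ (√lam₁)⁻¹ := by positivity
  obtain ⟨V, M, ω, hM, hω, hV0, hVc, hVd, hVdecay⟩ :=
    exists_decaying_semigroup hα hη0 hκ hγ hs hμ hcond hS hSs hSp hinj
  have hdom := mem_domain_posSqrt hSR
  refine ⟨fun t U₀ => ofState α S hdom (V t (toState α U₀)), ⟨fun U₀ => ?_, fun U₀ => ?_,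
    fun U hU t ht => ?_⟩, max 1 ((3 / 2 + α ^ 2) * M * (2 + 4 / α ^ 2)), ω, le_max_left _ _, hω,
    fun U₀ t ht => ?_⟩
  · simp only [hV0, ofState_toState hSR]
  · exact isWeakSolution_ofState hS hinj hSR hSA hdom (hVc _) (hVd _)
  · have h1 := eq_of_regularized_solutions hα hη0 hκ hγ hs hμ hcond hS hSs hinj
      (fun t ht => hU.hasDerivWithinAt_regularized hS hSR hSA ht) (hVd (toState α (U 0)))
      (hV0 _).symm ht
    simp only [← h1, ofState_toState hSR]
  · have h1 := energy_le (α := α) (ofState α S hdom (V t (toState α U₀)))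
    rw [toState_ofState hSR hinj] at h1
    have h2 := sqNorm_toState_le hα U₀
    have h3 := hVdecay (toState α U₀) t ht
    have hE : 0 ≤ energy A α U₀ := by unfold energy; positivity
    have hexp := (Real.exp_pos (-ω * t)).le
    calc _ ≤ (3 / 2 + α ^ 2) * (M * ((2 + 4 / α ^ 2) * energy A α U₀) * Real.exp (-ω * t)) := by
          refine h1.trans (mul_le_mul_of_nonneg_left (h3.trans ?_) (by positivity))
          gcongr
      _ = ((3 / 2 + α ^ 2) * M * (2 + 4 / α ^ 2)) * energy A α U₀ * Real.exp (-ω * t) := by ring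
      _ ≤ _ := by
          gcongr
          exact le_max_right _ _

end MGTFourier

theorem theorem6p3 {H : Type*} [NormedAddCommGroup H] [InnerProductSpace ℝ H] [CompleteSpace H]
    (A : H →ₗ.[ℝ] H) (hA : IsSelfAdjoint A)
    (hpos : ∃ c > 0, ∀ x : A.domain, c * ‖(x : H)‖ ^ 2 ≤ inner ℝ (A x) (x : H))
    (lam₁ : ℝ) (hlam₁ : IsLeast (MGTFourier.spectrumSet A) lam₁)
    (α β γ κ η : ℝ) (hα : 0 < α) (hβ : 0 < β) (hγ : 0 < γ) (hκ : 0 < κ)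
    (hμ : 0 ≤ γ - α * β) :
    (MGTFourier.threshold α lam₁ κ * (γ - α * β) < η ^ 2 →
      MGTFourier.ExponentiallyStable A α β γ κ η) ∧
    (γ - α * β = 0 → η ≠ 0 → MGTFourier.ExponentiallyStable A α β γ κ η) := by
  refine ⟨MGTFourier.exponentiallyStable_of_threshold_lt hA hpos hlam₁ hα hγ hκ hμ, fun h0 hη => ?_⟩
  refine MGTFourier.exponentiallyStable_of_threshold_lt hA hpos hlam₁ hα hγ hκ hμ ?_
  rw [h0, mul_zero]
  positivity
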